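/- For $r\ge 1$ let $\zeta_r(s_1,\ldots,s_r)=\sum_{1\le n_1<\cdots<n_r} n_1^{-s_1}\cdots n_r^{-s_r}$ (absolutely convergent if $\Re s_k>1$ for all $k$), continued meromorphically to $\mathbb{C}^r$; a singularity of $\zeta_r$ is a point of $\mathbb{C}^r$ at which the continuation is not holomorphic. Put $$F_{r-1}(s_2,\ldots,s_r)=\sum_{j=1}^{r-1}(-1)^{r-j+1}\zeta_j(s_{r-j+1},\ldots,s_r)-(-1)^r$$ (so $F_0=1$). Let $r\ge 1$ and let $D_{r-1}\subset\mathbb{C}^{r-1}$ be a bounded set such that for every point $(s_2,\ldots,s_r)$ of its closure and every $1\le j\le r-1$ the point $(s_{r-j+1},\ldots,s_r)$ is not a singularity of $\zeta_j$. Then $\zeta_r(s_1,\ldots,s_r)-F_{r-1}(s_2,\ldots,s_r)\to 0$ as $\Re s_1\to+\infty$, uniformly for $(s_2,\ldots,s_r)\in D_{r-1}$: for every $\varepsilon>0$ there is a real $X$ such that, whenever $\Re s_1\ge X$ and $(s_2,\ldots,s_r)\in D_{r-1}$, the point $(s_1,\ldots,s_r)$ is not a singularity of $\zeta_r$ and $$|\zeta_r(s_1,\ldots,s_r)-F_{r-1}(s_2,\ldots,s_r)|<\varepsilon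 .$$ In particular, if $(s_1^{(m)},\ldots,s_r^{(m)})$, $m=1,2,\ldots$, is a sequence in $\mathbb{C}^r$ with $\Re s_1^{(m)}\to+\infty$ and $(s_2^{(m)},\ldots,s_r^{(m)})\in D_{r-1}$ for all $m$, then for every $\varepsilon>0$ there is an $M$ such that for all $m\ge M$ the point $(s_1^{(m)},\ldots,s_r^{(m)})$ is not a singularity of $\zeta_r$ and $|\zeta_r(s_1^{(m)},\ldots,s_r^{(m)})-F_{r-1}(s_2^{(m)},\ldots,s_r^{(m)})|<\varepsilon$. -/

import Mathlib

open Filter Topology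

noncomputable section

/-- The index set of the Euler-Zagier sum: `1 ≤ n₁ < n₂ < ⋯ < n_r`. -/
abbrev MultiIndex (r : ℕ) : Type :=
  {n : Fin r → ℕ // StrictMono n ∧ ∀ i, 1 ≤ n i}

/-- The Euler-Zagier `r`-fold series `∑_{1 ≤ n₁ < ⋯ < n_r} n₁^{-s₁} ⋯ n_r^{-s_r}`
(absolutely convergent if `Re s_k > 1` for all `k`). -/
def multiZetaSeries (r : ℕ) (s : Fin r → ℂ) : ℂ :=
  ∑' n : MultiIndex r, ∏ i, 1 / ((n.1 i : ℂ) ^ (s i))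

/-- `f` is a meromorphic function on the whole of `ℂ^r`, holomorphic on the open set `U`, which
continues the Euler-Zagier series. Meromorphic: near every point `p` of `ℂ^r` there are holomorphic
`g`, `h` with `h` not identically zero near `p`, such that the complement of `U` lies in the zero
set of `h`, and `h f = g` on `U`. In particular `U` is dense and connected, so that, by the identity
theorem, any two continuations agree on the intersection of their domains. -/
def IsMultiZetaContinuation (r : ℕ) (U : Set (Fin r → ℂ)) (f : (Fin r → ℂ) → ℂ) : Prop :=
  IsOpen U ∧ AnalyticOnNhd ℂ f U ∧
  (∀ s ∈ U, (∀ i, 1 < (s i).re) → f s = multiZetaSeries r s) ∧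
  ∀ p : Fin r → ℂ, ∃ g h : (Fin r → ℂ) → ℂ,
    AnalyticAt ℂ g p ∧ AnalyticAt ℂ h p ∧ (¬ ∀ᶠ q in 𝓝 p, h q = 0) ∧
    ∀ᶠ q in 𝓝 p, (q ∉ U → h q = 0) ∧ (q ∈ U → h q * f q = g q)

/-- `p` is a regular point of `ζ_r`: the meromorphic continuation is holomorphic at `p`. -/
def MultiZetaRegularAt (r : ℕ) (p : Fin r → ℂ) : Prop :=
  ∃ U f, IsMultiZetaContinuation r U f ∧ p ∈ U

/-- The singularities of `ζ_r`. -/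
def multiZetaSingularities (r : ℕ) : Set (Fin r → ℂ) :=
  {p | ¬ MultiZetaRegularAt r p}

open Classical in
/-- The multiple zeta-function `ζ_r(s₁, …, s_r)`, meromorphically continued to `ℂ^r`
(with the value `0` at the singularities). -/
def multiZeta (r : ℕ) (s : Fin r → ℂ) : ℂ :=
  if H : MultiZetaRegularAt r s then H.choose_spec.choose s else 0

/-- The last `j + 1` entries of a `k`-tuple, for `j < k`. -/
def lastEntries {k : ℕ} (t : Fin k → ℂ) (j : Fin k) : Fin (j.1 + 1) → ℂ :=
  fun i => t ⟨k - (j.1 + 1) + i.1, by omega⟩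

/-- `F_{r-1}(s₂, …, s_r) = ∑_{j=1}^{r-1} (-1)^{r-j+1} ζ_j(s_{r-j+1}, …, s_r) - (-1)^r`, where
`r = k + 1`, `t = (s₂, …, s_r)`, and the summation index `j` is written as `i + 1`, `i < k`. -/
def limitF (k : ℕ) (t : Fin k → ℂ) : ℂ :=
  ∑ i : Fin k, (-1 : ℂ) ^ ((k + 1) - (i.1 + 1) + 1) * multiZeta (i.1 + 1) (lastEntries t i)
    - (-1 : ℂ) ^ (k + 1)

end

/-! For `Re s₁` large, sum over the smallest index last: `ζ_r = ∑_{n ≥ 1} n^{-s₁} T_n(s₂, …, s_r)`,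
where `T_n` is the `(r-1)`-fold series over indices larger than `n`. By inclusion-exclusion `T_n` is
a finite combination of the `ζ_j(s_{r-j+1}, …, s_r)` with coefficients of at most polynomial growth
in `n` (`tailZeta`). So on a compact set of regular tails `|T_n| ≤ B n^A` uniformly
(`exists_norm_tailZeta_le`). The term `n = 1` is `T_1 = F_{r-1}` (`tailZeta_one_eq_limitF`), and the
remaining terms are together `O(2^{-Re s₁})` (`norm_tsum_sub_first_le`). A compact neighbourhood of
the closure of `D` consisting of regular tails makes this uniform on `D`.

It must also be shown that a continuation exists and that this series computes it. Existence
(`hasQuotients`) is by induction on the depth. Expanding `(n+1)^{1-s₁}` in powers of `1/n` and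
summing by parts expresses `(s₁ - 1) ζ_r` through functions of depth `r - 1`, shifts of `s₁` to the
right, and a remainder that converges further to the left (`sub_one_mul_multiZetaSeries`).
Repetition moves the domain of `s₁` left one unit at a time.

Continuations are handled as quotients `g / h` of analytic functions on half-spaces, which are
connected and meet the region of convergence. Values at regular points, including zeros of `h`, are
then unique (`IsLocalValue.unique`), and every continuation agrees with them
(`IsMultiZetaContinuation.mul_eq`). -/

noncomputable section

/-! ### Dominated sums of analytic functions of several variables -/

section AnalyticSums

variable {E F : Type*} [NormedAddCommGroup E] [NormedSpace ℂ E]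
  [NormedAddCommGroup F] [NormedSpace ℂ F]

/-- Iterated Cauchy estimates on shrinking balls. -/
theorem norm_iteratedFDeriv_le_of_bounded [CompleteSpace F] {f : E → F} {x : E} {R M δ : ℝ}
    (hM : 0 ≤ M) (hδ : 0 < δ) (hf : AnalyticOnNhd ℂ f (Metric.ball x R))
    (hb : ∀ y ∈ Metric.ball x R, ‖f y‖ ≤ M) (k : ℕ) :
    ∀ y ∈ Metric.ball x (R - k * δ), ‖iteratedFDeriv ℂ k f y‖ ≤ M * (2 / δ) ^ k := by
  induction k with
  | zero => simpa using hb
  | succ k ih =>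
    intro y hy
    have hsub : Metric.ball y δ ⊆ Metric.ball x (R - k * δ) := by
      apply Metric.ball_subset_ball'
      have := Metric.mem_ball.1 hy
      push_cast at this
      linarith
    have hsub' : Metric.ball y δ ⊆ Metric.ball x R :=
      hsub.trans (Metric.ball_subset_ball (by nlinarith [(Nat.cast_nonneg k : (0 : ℝ) ≤ k)]))
    have hpos : 0 ≤ M * (2 / δ) ^ k := by positivity
    rw [← norm_fderiv_iteratedFDeriv]
    have hd : DifferentiableOn ℂ (iteratedFDeriv ℂ k f) (Metric.ball y δ) :=
      ((hf.iteratedFDeriv k).mono hsub').differentiableOn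
    have hm : Set.MapsTo (iteratedFDeriv ℂ k f) (Metric.ball y δ)
        (Metric.closedBall (iteratedFDeriv ℂ k f y) (2 * (M * (2 / δ) ^ k))) := by
      intro z hz
      rw [Metric.mem_closedBall, dist_eq_norm]
      have h1 := ih z (hsub hz)
      have h2 := ih y (hsub (Metric.mem_ball_self hδ))
      have := norm_sub_le (iteratedFDeriv ℂ k f z) (iteratedFDeriv ℂ k f y)
      linarith
    have := Complex.norm_fderiv_le_div_of_mapsTo_ball hd hm hδ
    calc _ ≤ _ := this
      _ = _ := by rw [pow_succ]; ring

/-- The Taylor coefficients of `f` at `x`, as a formal multilinear series. -/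
def taylorFMS (f : E → F) (x : E) : FormalMultilinearSeries ℂ E F :=
  fun k => ((k.factorial : ℂ))⁻¹ • iteratedFDeriv ℂ k f x

/-- The `k` Cauchy estimates share the radius equally, with step `R / (k + 1)`. The resulting factor
`(k + 1)^k / k!` is at most `e^{k+1}`, so the bound stays geometric in `k` and linear in `M`, which
allows summation over a family of functions. -/
theorem norm_taylorFMS_le [CompleteSpace F] {f : E → F} {x : E} {R M : ℝ}
    (hM : 0 ≤ M) (hR : 0 < R) (hf : AnalyticOnNhd ℂ f (Metric.ball x R))
    (hb : ∀ y ∈ Metric.ball x R, ‖f y‖ ≤ M) (k : ℕ) :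
    ‖taylorFMS f x k‖ ≤ M * Real.exp 1 * (2 * Real.exp 1 / R) ^ k := by
  have hk : (0 : ℝ) < k + 1 := by positivity
  have h1 := norm_iteratedFDeriv_le_of_bounded hM (div_pos hR hk) hf hb k x (by
    rw [Metric.mem_ball, dist_self]
    have : R - k * (R / (k + 1)) = R / (k + 1) := by field_simp; ring
    rw [this]; positivity)
  have h2 := Real.pow_div_factorial_le_exp ((k : ℝ) + 1) hk.le k
  rw [taylorFMS, norm_smul, norm_inv, Complex.norm_natCast]
  calc _ ≤ ((k.factorial : ℝ))⁻¹ * (M * (2 / (R / (k + 1))) ^ k) := by gcongr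
    _ = M * (2 / R) ^ k * (((k : ℝ) + 1) ^ k / k.factorial) := by
      have : 2 / (R / ((k : ℝ) + 1)) = 2 / R * (k + 1) := by field_simp
      rw [this, mul_pow]; ring
    _ ≤ M * (2 / R) ^ k * Real.exp (k + 1) := by gcongr
    _ = _ := by
      rw [Real.exp_add, ← Real.exp_one_pow, div_pow, div_pow, mul_pow]; ring

theorem ofReal_le_radius_taylorFMS [CompleteSpace F] {f : E → F} {x : E} {R M : ℝ}
    (hM : 0 ≤ M) (hR : 0 < R) (hf : AnalyticOnNhd ℂ f (Metric.ball x R))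
    (hb : ∀ y ∈ Metric.ball x R, ‖f y‖ ≤ M) :
    ENNReal.ofReal (R / (2 * Real.exp 1)) ≤ (taylorFMS f x).radius := by
  refine FormalMultilinearSeries.le_radius_of_bound _ (M * Real.exp 1) fun k => ?_
  rw [Real.coe_toNNReal _ (by positivity)]
  calc _ ≤ M * Real.exp 1 * (2 * Real.exp 1 / R) ^ k * (R / (2 * Real.exp 1)) ^ k := by
        gcongr; exact norm_taylorFMS_le hM hR hf hb k
    _ = M * Real.exp 1 := by
      rw [mul_assoc, ← mul_pow]
      have : 2 * Real.exp 1 / R * (R / (2 * Real.exp 1)) = 1 := by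
        have := Real.exp_pos 1
        field_simp
      rw [this]; simp

/-- The coefficient bound gives convergence on a radius depending only on `R`, not on `f`. The sum
equals `f` near the centre, hence on the whole ball by the identity theorem. -/
theorem hasSum_taylorFMS [CompleteSpace F] {f : E → F} {x : E} {R M : ℝ}
    (hM : 0 ≤ M) (hR : 0 < R) (hf : AnalyticOnNhd ℂ f (Metric.ball x R))
    (hb : ∀ y ∈ Metric.ball x R, ‖f y‖ ≤ M) {y : E} (hy : ‖y‖ < R / (2 * Real.exp 1)) :
    HasSum (fun k => taylorFMS f x k fun _ => y) (f (x + y)) := by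
  have hr0 : 0 < R / (2 * Real.exp 1) := by positivity
  have hrR : R / (2 * Real.exp 1) ≤ R := by
    rw [div_le_iff₀ (by positivity)]
    nlinarith [Real.add_one_le_exp 1]
  have hrad := ofReal_le_radius_taylorFMS hM hR hf hb
  have hps := ((taylorFMS f x).hasFPowerSeriesOnBall
    (lt_of_lt_of_le (ENNReal.ofReal_pos.2 hr0) hrad)).mono (ENNReal.ofReal_pos.2 hr0) hrad
  have han := hps.analyticOnNhd
  rw [Metric.eball_ofReal] at han
  have han2 : AnalyticOnNhd ℂ (fun y => f (x + y))
      (Metric.ball 0 (R / (2 * Real.exp 1))) := by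
    intro z hz
    have : AnalyticAt ℂ f (x + z) := hf _ (by
      rw [Metric.mem_ball, dist_eq_norm]
      simpa using lt_of_lt_of_le (mem_ball_zero_iff.1 hz) hrR)
    exact this.fun_comp (analyticAt_const.add analyticAt_id)
  have hev : (taylorFMS f x).sum =ᶠ[𝓝 0] fun y => f (x + y) := by
    obtain ⟨p, r, hp⟩ := hf x (Metric.mem_ball_self hR)
    filter_upwards [Metric.eball_mem_nhds (0 : E) hp.r_pos] with z hz
    have h1 := hp.hasSum_iteratedFDeriv hz
    exact h1.tsum_eq
  have heq := han.eqOn_of_preconnected_of_eventuallyEq han2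
    (convex_ball (0 : E) _).isPreconnected (Metric.mem_ball_self hr0) hev
  have hmem : y ∈ Metric.ball (0 : E) (R / (2 * Real.exp 1)) := mem_ball_zero_iff.2 hy
  have h3 := hps.hasSum (y := y) (by rw [Metric.eball_ofReal]; exact hmem)
  rw [zero_add, heq hmem] at h3
  exact h3

/-- A sum of analytic functions which is locally dominated by a convergent series is analytic. -/
theorem analyticAt_tsum [CompleteSpace F] {ι : Type*} {f : ι → E → F} {x : E} {u : ι → ℝ}
    (hu : Summable u)
    (hf : ∀ᶠ y in 𝓝 x, ∀ i, AnalyticAt ℂ (f i) y) (hb : ∀ᶠ y in 𝓝 x, ∀ i, ‖f i y‖ ≤ u i) :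
    AnalyticAt ℂ (fun y => ∑' i, f i y) x := by
  obtain ⟨R, hR, hball⟩ := Metric.eventually_nhds_iff_ball.1 (hf.and hb)
  have hu0 : ∀ i, 0 ≤ u i := fun i =>
    (norm_nonneg _).trans ((hball x (Metric.mem_ball_self hR)).2 i)
  have hfa : ∀ i, AnalyticOnNhd ℂ (f i) (Metric.ball x R) := fun i y hy => (hball y hy).1 i
  have hfb : ∀ i, ∀ y ∈ Metric.ball x R, ‖f i y‖ ≤ u i := fun i y hy => (hball y hy).2 i
  set r : ℝ := R / (2 * Real.exp 1) with hr
  have hr0 : 0 < r := by positivity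
  have hcoef : ∀ i k, ‖taylorFMS (f i) x k‖ ≤ u i * (Real.exp 1 * (r⁻¹) ^ k) := by
    intro i k
    refine (norm_taylorFMS_le (hu0 i) hR (hfa i) (hfb i) k).trans_eq ?_
    rw [hr, inv_div, mul_assoc]
  have hsumk : ∀ k, Summable fun i => taylorFMS (f i) x k := fun k =>
    Summable.of_norm_bounded (hu.mul_right _) fun i => hcoef i k
  set q : FormalMultilinearSeries ℂ E F := fun k => ∑' i, taylorFMS (f i) x k with hq
  have hqn : ∀ k, ‖q k‖ ≤ (∑' i, u i) * (Real.exp 1 * (r⁻¹) ^ k) := fun k =>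
    tsum_of_norm_bounded ((hu.hasSum).mul_right _) fun i => hcoef i k
  have hps : HasFPowerSeriesOnBall (fun y => ∑' i, f i y) q x (ENNReal.ofReal r) := by
    refine ⟨?_, ENNReal.ofReal_pos.2 hr0, ?_⟩
    · refine FormalMultilinearSeries.le_radius_of_bound _ ((∑' i, u i) * Real.exp 1) fun k => ?_
      rw [Real.coe_toNNReal _ hr0.le]
      calc _ ≤ (∑' i, u i) * (Real.exp 1 * (r⁻¹) ^ k) * r ^ k := by gcongr; exact hqn k
        _ = _ := by
          rw [inv_pow]
          have : r ^ k ≠ 0 := by positivity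
          field_simp
    · intro y hy
      rw [Metric.eball_ofReal, mem_ball_zero_iff] at hy
      have hterm : ∀ i k, ‖taylorFMS (f i) x k fun _ => y‖ ≤
          u i * (Real.exp 1 * (‖y‖ / r) ^ k) := by
        intro i k
        calc _ ≤ ‖taylorFMS (f i) x k‖ * ‖y‖ ^ k := by
              simpa using (taylorFMS (f i) x k).le_opNorm fun _ => y
          _ ≤ u i * (Real.exp 1 * (r⁻¹) ^ k) * ‖y‖ ^ k := by gcongr; exact hcoef i k
          _ = _ := by rw [div_eq_mul_inv, mul_pow]; ring
      have hgeo : Summable fun k : ℕ => Real.exp 1 * (‖y‖ / r) ^ k :=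
        (summable_geometric_of_lt_one (by positivity) ((div_lt_one hr0).2 hy)).mul_left _
      -- Absolute convergence of the double series over degree and index justifies interchanging the
      -- two sums.
      have hprod : Summable fun a : ℕ × ι => taylorFMS (f a.2) x a.1 fun _ => y := by
        refine Summable.of_norm_bounded
          (g := fun a : ℕ × ι => (Real.exp 1 * (‖y‖ / r) ^ a.1) * u a.2)
          (hgeo.mul_of_nonneg hu (fun k => by positivity) hu0) fun a => ?_
        rw [mul_comm]; exact hterm _ _
      have happ : ∀ k, q k (fun _ => y) = ∑' i, taylorFMS (f i) x k fun _ => y := by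
        intro k
        exact ContinuousMultilinearMap.tsum_eval (hsumk k) _
      have hs : HasSum (fun k => q k fun _ => y) (∑' a : ℕ × ι, taylorFMS (f a.2) x a.1 fun _ => y) := by
        simp_rw [happ]
        exact hprod.hasSum.prod_fiberwise fun k => (hprod.prod_factor k).hasSum
      have : (∑' a : ℕ × ι, taylorFMS (f a.2) x a.1 fun _ => y) = ∑' i, f i (x + y) := by
        rw [← (Equiv.prodComm ι ℕ).tsum_eq]
        have hprod' := (Equiv.prodComm ι ℕ).summable_iff.2 hprod
        refine (Summable.tsum_prod hprod').trans ?_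
        refine tsum_congr fun i => ?_
        exact (hasSum_taylorFMS (hu0 i) hR (hfa i) (hfb i) hy).tsum_eq
      rw [← this]
      exact hs
  exact ⟨q, _, hps⟩

end AnalyticSums

/-! ### Tails of the Euler-Zagier series in the region of convergence -/

section TailSeries

/-- The Euler-Zagier series restricted to `N < n₁ < ⋯ < n_k`. -/
def tailSeries (k N : ℕ) (s : Fin k → ℂ) : ℂ :=
  ∑' n : {n : Fin k → ℕ // StrictMono n ∧ ∀ i, N < n i}, ∏ i, 1 / ((n.1 i : ℂ) ^ (s i))

theorem multiZetaSeries_eq_tailSeries (k : ℕ) (s : Fin k → ℂ) :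
    multiZetaSeries k s = tailSeries k 0 s := rfl

theorem summable_norm_prod_cpow {k : ℕ} {s : Fin k → ℂ} (hs : ∀ i, 1 < (s i).re) :
    Summable fun n : Fin k → ℕ => ‖∏ i, 1 / ((n i : ℂ) ^ (s i))‖ := by
  induction k with
  | zero => exact (hasSum_fintype _).summable
  | succ k ih =>
    have h0 := (Complex.summable_one_div_nat_cpow.2 (hs 0)).norm
    have h1 := ih (s := Fin.tail s) fun i => hs i.succ
    have h2 := h0.mul_of_nonneg h1 (fun _ => norm_nonneg _) (fun _ => norm_nonneg _)
    rw [← (Fin.consEquiv fun _ : Fin (k + 1) => ℕ).summable_iff]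
    refine h2.congr fun a => ?_
    simp [Fin.consEquiv, Fin.prod_univ_succ, Fin.tail, mul_comm]

theorem tailSeries_zero (N : ℕ) (s : Fin 0 → ℂ) : tailSeries 0 N s = 1 := by
  have : Unique {n : Fin 0 → ℕ // StrictMono n ∧ ∀ i, N < n i} :=
    { default := ⟨Fin.elim0, fun i => i.elim0, fun i => i.elim0⟩
      uniq := fun a => Subtype.ext (Subsingleton.elim _ _) }
  rw [tailSeries, tsum_fintype]
  simp

/-- The sum of absolute values over all tuples, ordered or not, dominates every tail at once. -/
theorem exists_norm_tailSeries_le {k : ℕ} {s : Fin k → ℂ} (hs : ∀ i, 1 < (s i).re) :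
    ∃ C, 0 ≤ C ∧ ∀ N, ‖tailSeries k N s‖ ≤ C := by
  have h := summable_norm_prod_cpow hs
  refine ⟨∑' n : Fin k → ℕ, ‖∏ i, 1 / ((n i : ℂ) ^ (s i))‖, tsum_nonneg fun n => norm_nonneg _, fun N => ?_⟩
  refine (norm_tsum_le_tsum_norm (h.subtype _)).trans ?_
  exact h.tsum_subtype_le _ _ fun n => norm_nonneg _

/-- Prepending an entry `N + 1 + i` to a strictly increasing tuple of larger entries. -/
def consIndex (k N : ℕ) :
    (Σ i : ℕ, {n : Fin k → ℕ // StrictMono n ∧ ∀ j, N + 1 + i < n j}) →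
      {n : Fin (k + 1) → ℕ // StrictMono n ∧ ∀ j, N < n j} :=
  fun a => ⟨Fin.cons (N + 1 + a.1) a.2.1, by
    refine ⟨Fin.strictMono_iff_lt_succ.2 fun j => ?_, fun j => ?_⟩
    · rcases a with ⟨i, n, hn, hN⟩
      cases k with
      | zero => exact j.elim0
      | succ k =>
        refine Fin.cases ?_ (fun l => ?_) j
        · simpa using hN 0
        · rw [← Fin.succ_castSucc, Fin.cons_succ, Fin.cons_succ]
          exact hn (Fin.castSucc_lt_succ)
    · refine Fin.cases ?_ (fun l => ?_) j
      · simp; omega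
      · have := a.2.2.2 l
        simp; omega⟩

theorem consIndex_bijective (k N : ℕ) : Function.Bijective (consIndex k N) := by
  constructor
  · rintro ⟨i, n, hn⟩ ⟨i', n', hn'⟩ h
    have h' := congrArg Subtype.val h
    simp only [consIndex, Fin.cons_inj] at h'
    obtain ⟨h1, h2⟩ := h'
    obtain rfl : i = i' := by omega
    subst h2
    rfl
  · rintro ⟨n, hn, hN⟩
    have h0 := hN 0
    refine ⟨⟨n 0 - (N + 1), Fin.tail n, fun a b hab => hn (Fin.succ_lt_succ_iff.2 hab),
      fun j => ?_⟩, ?_⟩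
    · have : n 0 < n j.succ := hn (Fin.succ_pos j)
      simp only [Fin.tail]; omega
    · apply Subtype.ext
      have : N + 1 + (n 0 - (N + 1)) = n 0 := by omega
      simp only [consIndex, this, Fin.cons_self_tail]

theorem hasSum_tailSeries_succ {k : ℕ} (N : ℕ) {s : Fin (k + 1) → ℂ} (hs : ∀ i, 1 < (s i).re) :
    HasSum (fun i : ℕ => 1 / (((N + 1 + i : ℕ) : ℂ) ^ (s 0)) *
      tailSeries k (N + 1 + i) (Fin.tail s)) (tailSeries (k + 1) N s) := by
  have h : Summable fun n : {n : Fin (k + 1) → ℕ // StrictMono n ∧ ∀ j, N < n j} =>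
      ∏ i, 1 / ((n.1 i : ℂ) ^ (s i)) := ((summable_norm_prod_cpow hs).of_norm).subtype _
  have ht (N : ℕ) : Summable fun n : {n : Fin k → ℕ // StrictMono n ∧ ∀ j, N < n j} =>
      ∏ i, 1 / ((n.1 i : ℂ) ^ (Fin.tail s i)) :=
    ((summable_norm_prod_cpow (s := Fin.tail s) fun i => hs i.succ).of_norm).subtype _
  set e := Equiv.ofBijective _ (consIndex_bijective k N)
  have h1 := (e.hasSum_iff).2 h.hasSum
  refine h1.sigma fun i => ?_
  have h2 := ((ht (N + 1 + i)).hasSum).mul_left (1 / (((N + 1 + i : ℕ) : ℂ) ^ (s 0)))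
  refine Eq.mp (congrArg (fun f => HasSum f _) (funext fun n => ?_)) h2
  simp [e, consIndex, Fin.prod_univ_succ, Fin.tail, mul_comm]

/-- Only the tuples with smallest entry `N + 1` separate the two tails. -/
theorem tailSeries_sub_tailSeries {k : ℕ} (N : ℕ) {s : Fin (k + 1) → ℂ}
    (hs : ∀ i, 1 < (s i).re) :
    tailSeries (k + 1) N s - tailSeries (k + 1) (N + 1) s =
      1 / (((N + 1 : ℕ) : ℂ) ^ (s 0)) * tailSeries k (N + 1) (Fin.tail s) := by
  have h1 := hasSum_tailSeries_succ N hs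
  have h2 := hasSum_tailSeries_succ (N + 1) hs
  rw [← h1.tsum_eq, h1.summable.tsum_eq_zero_add, ← h2.tsum_eq]
  have (i : ℕ) : N + 1 + (i + 1) = N + 1 + 1 + i := by ring
  rw [tsum_congr fun i => by rw [this i], add_zero, add_sub_cancel_right]

theorem tailSeries_succ_eq_sub_sum {k : ℕ} (N : ℕ) {s : Fin (k + 1) → ℂ}
    (hs : ∀ i, 1 < (s i).re) :
    tailSeries (k + 1) N s = multiZetaSeries (k + 1) s -
      ∑ m ∈ Finset.range N, 1 / (((m + 1 : ℕ) : ℂ) ^ (s 0)) *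
        tailSeries k (m + 1) (Fin.tail s) := by
  induction N with
  | zero => simp [multiZetaSeries_eq_tailSeries]
  | succ N ih =>
    rw [Finset.sum_range_succ, ← tailSeries_sub_tailSeries N hs, ← sub_sub, ← ih]
    ring

theorem hasSum_multiZetaSeries_succ {k : ℕ} {s : Fin (k + 1) → ℂ} (hs : ∀ i, 1 < (s i).re) :
    HasSum (fun i : ℕ => ((i + 1 : ℕ) : ℂ) ^ (-s 0) * tailSeries k (i + 1) (Fin.tail s))
      (multiZetaSeries (k + 1) s) := by
  refine Eq.mp (congrArg (fun f => HasSum f _) (funext fun i => ?_)) (hasSum_tailSeries_succ 0 hs)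
  rw [Complex.cpow_neg, one_div, show 0 + 1 + i = i + 1 by ring]

end TailSeries

/-! ### The translation formula in the first variable -/

section Translation

/-- The binomial coefficient `(1 - w choose j)`. -/
def shiftCoeff : ℕ → ℂ → ℂ
  | 0, _ => 1
  | j + 1, w => (1 - w) * shiftCoeff j (w + 1) / (j + 1)

theorem analyticOnNhd_shiftCoeff (j : ℕ) : AnalyticOnNhd ℂ (shiftCoeff j) Set.univ := by
  induction j with
  | zero => exact analyticOnNhd_const
  | succ j ih =>
    intro w _
    have h1 : AnalyticAt ℂ (fun w : ℂ => shiftCoeff j (w + 1)) w :=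
      AnalyticAt.fun_comp (f := fun w : ℂ => w + 1) (ih (w + 1) trivial) (by fun_prop)
    exact ((analyticAt_const.sub analyticAt_id).mul h1).div analyticAt_const
      (Nat.cast_add_one_ne_zero j)

/-- Differentiation lowers the order of the binomial remainder by one and shifts `w` to `w + 1`; the
recursion defining `shiftCoeff` is chosen for this. It drives the induction in the next estimate. -/
theorem hasDerivAt_one_add_cpow_sub_sum (K : ℕ) (w : ℂ) {x : ℝ} (hx : 0 ≤ x) :
    HasDerivAt (fun x : ℝ => (1 + (x : ℂ)) ^ (1 - w) -
        ∑ j ∈ Finset.range (K + 1), shiftCoeff j w * (x : ℂ) ^ j)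
      ((1 - w) * ((1 + (x : ℂ)) ^ (1 - (w + 1)) -
        ∑ j ∈ Finset.range K, shiftCoeff j (w + 1) * (x : ℂ) ^ j)) x := by
  have h1 : HasDerivAt (fun z : ℂ => (1 + z) ^ (1 - w)) ((1 - w) * (1 + (x : ℂ)) ^ (1 - w - 1) * 1)
      (x : ℂ) := by
    refine HasDerivAt.cpow_const ((hasDerivAt_id _).const_add 1) (Or.inl ?_)
    simp; linarith
  have h2 : HasDerivAt (fun z : ℂ => ∑ j ∈ Finset.range (K + 1), shiftCoeff j w * z ^ j)
      (∑ j ∈ Finset.range (K + 1), shiftCoeff j w * (j * (x : ℂ) ^ (j - 1))) (x : ℂ) :=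
    HasDerivAt.fun_sum fun j _ => (hasDerivAt_pow j (x : ℂ)).const_mul _
  have h3 := (h1.sub h2).comp_ofReal
  refine h3.congr_deriv ?_
  rw [Finset.sum_range_succ', mul_sub, Finset.mul_sum]
  congr 1
  · rw [mul_one]; congr 2; ring
  · simp only [Nat.cast_zero, zero_mul, mul_zero, add_zero]
    refine Finset.sum_congr rfl fun j _ => ?_
    have : (j : ℂ) + 1 ≠ 0 := Nat.cast_add_one_ne_zero j
    simp only [shiftCoeff, Nat.cast_add, Nat.cast_one, Nat.add_sub_cancel]
    field_simp

/-- Induction on the order: the remainder vanishes at `x = 0` and its derivative is controlled by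
the previous order, so the mean value inequality gains a factor `x`. The radius grows by one because
`w` is replaced by `w + 1`. -/
theorem exists_norm_one_add_cpow_sub_sum_le (K : ℕ) (R : ℝ) :
    ∃ M, 0 ≤ M ∧ ∀ w : ℂ, ‖w‖ ≤ R → ∀ x : ℝ, 0 ≤ x → x ≤ 1 →
      ‖(1 + (x : ℂ)) ^ (1 - w) - ∑ j ∈ Finset.range K, shiftCoeff j w * (x : ℂ) ^ j‖
        ≤ M * x ^ K := by
  induction K generalizing R with
  | zero =>
    refine ⟨2 ^ (1 + R), by positivity, fun w hw x hx hx1 => ?_⟩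
    have h1 : (1 + (x : ℂ)) = ((1 + x : ℝ) : ℂ) := by push_cast; ring
    have h0 : (0 : ℝ) < 1 + x := by linarith
    have hre : -w.re ≤ R := (neg_le_abs _).trans ((Complex.abs_re_le_norm w).trans hw)
    have hR : 0 ≤ R := (norm_nonneg _).trans hw
    rw [Finset.sum_range_zero, sub_zero, pow_zero, mul_one, h1,
      Complex.norm_cpow_eq_rpow_re_of_pos h0]
    calc _ ≤ (1 + x) ^ (1 + R) := by
          apply Real.rpow_le_rpow_of_exponent_le (by linarith)
          simp; linarith
      _ ≤ _ := by
          apply Real.rpow_le_rpow h0.le (by linarith) (by linarith)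
  | succ K ih =>
    obtain ⟨M, hM, hb⟩ := ih (R + 1)
    refine ⟨(1 + |R|) * M, by positivity, fun w hw x hx hx1 => ?_⟩
    have hw1 : ‖w + 1‖ ≤ R + 1 := (norm_add_le _ _).trans (by simpa using hw)
    have hw2 : ‖1 - w‖ ≤ 1 + |R| := (norm_sub_le _ _).trans (by
      rw [norm_one]; linarith [le_abs_self R])
    have := (convex_Icc (0 : ℝ) x).norm_image_sub_le_of_norm_hasDerivWithin_le
      (f := fun x : ℝ => (1 + (x : ℂ)) ^ (1 - w) -
        ∑ j ∈ Finset.range (K + 1), shiftCoeff j w * (x : ℂ) ^ j)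
      (C := (1 + |R|) * (M * x ^ K))
      (fun t ht => (hasDerivAt_one_add_cpow_sub_sum K w ht.1).hasDerivWithinAt)
      (fun t ht => by
        rw [norm_mul]
        have h1 := hb (w + 1) hw1 t ht.1 (ht.2.trans hx1)
        have h2 : t ^ K ≤ x ^ K := pow_le_pow_left₀ ht.1 ht.2 K
        have h3 := mul_le_mul_of_nonneg_left h2 hM
        exact mul_le_mul hw2 (h1.trans h3) (norm_nonneg _) (by positivity))
      (Set.left_mem_Icc.2 hx) (Set.right_mem_Icc.2 hx)
    rw [Finset.sum_range_succ' _ K] at this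
    simp only [Finset.sum_range_succ' _ K, Complex.ofReal_zero, add_zero, Complex.one_cpow, ne_eq,
      Nat.add_eq_zero_iff, one_ne_zero, and_false, not_false_eq_true, zero_pow, mul_zero,
      Finset.sum_const_zero, pow_zero, shiftCoeff, mul_one, zero_add, sub_self, sub_zero,
      Real.norm_eq_abs, abs_of_nonneg hx] at this ⊢
    refine this.trans_eq ?_
    ring

/-- The remainder of the binomial expansion of `(n + 1)^{1 - w}` in powers of `1 / n`. -/
def shiftRemainder (K n : ℕ) (w : ℂ) : ℂ :=
  ((n + 1 : ℕ) : ℂ) ^ (1 - w) - ∑ j ∈ Finset.range K, shiftCoeff j w * (n : ℂ) ^ (1 - w - j)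

theorem exists_norm_shiftRemainder_le (K : ℕ) (R : ℝ) :
    ∃ M, 0 ≤ M ∧ ∀ w : ℂ, ‖w‖ ≤ R → ∀ n : ℕ, 1 ≤ n →
      ‖shiftRemainder K n w‖ ≤ M * (n : ℝ) ^ (1 - w.re - K) := by
  obtain ⟨M, hM, hb⟩ := exists_norm_one_add_cpow_sub_sum_le K R
  refine ⟨M, hM, fun w hw n hn => ?_⟩
  have hn0 : (0 : ℝ) < n := by exact_mod_cast hn
  have hnC : (n : ℂ) ≠ 0 := by exact_mod_cast hn0.ne'
  have hx := hb w hw (1 / n) (by positivity) (by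
    rw [div_le_one hn0]; exact_mod_cast hn)
  -- Factoring out `n^{1-w}` reduces to the remainder of `(1 + x)^{1-w}` at `x = 1/n`.
  have hkey : shiftRemainder K n w = (n : ℂ) ^ (1 - w) * ((1 + ((1 / n : ℝ) : ℂ)) ^ (1 - w) -
      ∑ j ∈ Finset.range K, shiftCoeff j w * ((1 / n : ℝ) : ℂ) ^ j) := by
    rw [mul_sub, Finset.mul_sum, shiftRemainder]
    congr 1
    · have h1 : (1 + ((1 / n : ℝ) : ℂ)) = ((1 + 1 / n : ℝ) : ℂ) := by push_cast; ring
      have h2 : (n : ℂ) = ((n : ℝ) : ℂ) := by push_cast; ring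
      rw [h1, h2, ← Complex.mul_cpow_ofReal_nonneg hn0.le (by positivity), ← Complex.ofReal_mul]
      congr 1
      have : (n : ℝ) * (1 + 1 / n) = n + 1 := by field_simp
      rw [this]; push_cast; ring
    · refine Finset.sum_congr rfl fun j _ => ?_
      rw [Complex.cpow_sub _ _ hnC, Complex.cpow_natCast]
      push_cast
      rw [one_div, inv_pow]
      ring
  rw [hkey, norm_mul, Complex.norm_natCast_cpow_of_pos hn]
  calc _ ≤ (n : ℝ) ^ (1 - w).re * (M * (1 / n) ^ K) := by gcongr
    _ = _ := by
      rw [Real.rpow_sub hn0 _ (K : ℝ), Real.rpow_natCast, one_div, inv_pow]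
      simp
      ring

theorem analyticOnNhd_natCast_cpow {n : ℕ} (hn : 1 ≤ n) {g : ℂ → ℂ}
    (hg : AnalyticOnNhd ℂ g Set.univ) : AnalyticOnNhd ℂ (fun w => (n : ℂ) ^ g w) Set.univ :=
  fun w hw => AnalyticAt.cpow analyticAt_const (hg w hw) (by
    rw [Complex.natCast_mem_slitPlane]; omega)

theorem analyticOnNhd_shiftRemainder (K : ℕ) {n : ℕ} (hn : 1 ≤ n) :
    AnalyticOnNhd ℂ (shiftRemainder K n) Set.univ := by
  refine AnalyticOnNhd.sub ?_ ?_
  · exact analyticOnNhd_natCast_cpow (Nat.le_add_left 1 n)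
      (analyticOnNhd_const.sub analyticOnNhd_id)
  · exact Finset.analyticOnNhd_fun_sum _ fun j _ => (analyticOnNhd_shiftCoeff j).mul
      (analyticOnNhd_natCast_cpow hn
        ((analyticOnNhd_const.sub analyticOnNhd_id).sub analyticOnNhd_const))

/-- The binomial expansion of a difference of consecutive powers, solved for `(w - 1) n^{-w}`. -/
theorem sub_one_mul_cpow_neg (L n : ℕ) (w : ℂ) :
    (w - 1) * (n : ℂ) ^ (-w) = ((n : ℂ) ^ (1 - w) - ((n + 1 : ℕ) : ℂ) ^ (1 - w)) +
      ∑ j ∈ Finset.range L, shiftCoeff (j + 2) w * (n : ℂ) ^ (-(w + (j + 1))) +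
      shiftRemainder (L + 2) n w := by
  rw [shiftRemainder, Finset.sum_range_succ', Finset.sum_range_succ']
  have h1 : ∀ j : ℕ, (1 : ℂ) - w - ((j + 1 + 1 : ℕ) : ℂ) = -(w + (j + 1)) := fun j => by
    push_cast; ring
  simp only [h1, shiftCoeff]
  have h2 : (1 : ℂ) - w - ((0 + 1 : ℕ) : ℂ) = -w := by push_cast; ring
  rw [h2]
  simp
  ring

/-- Summation by parts. -/
theorem sum_range_sub_mul (a T : ℕ → ℂ) (N : ℕ) :
    ∑ i ∈ Finset.range N, (a (i + 1) - a (i + 2)) * T (i + 1) =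
      a 1 * T 0 - a (N + 1) * T N - ∑ i ∈ Finset.range N, a (i + 1) * (T i - T (i + 1)) := by
  induction N with
  | zero => simp
  | succ N ih => rw [Finset.sum_range_succ, Finset.sum_range_succ, ih]; ring

/-- `ζ_k(s₁ + s₂ - 1, s₃, …)` as a series, and `0` if there is only one variable. -/
def mergedSeries : (k : ℕ) → (Fin (k + 1) → ℂ) → ℂ
  | 0, _ => 0
  | k + 1, s => multiZetaSeries (k + 1) (Fin.cons (s 0 + s 1 - 1) (Fin.tail (Fin.tail s)))

/-- A difference of consecutive tails is `(i+1)^{-s₂}` times a tail of depth one less, so the powers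
of `i + 1` combine to the exponent `-(s₁ + s₂ - 1)`. In depth one all tails equal `1` and the
differences vanish. -/
theorem hasSum_cpow_mul_tailSeries_sub {k : ℕ} {s : Fin (k + 1) → ℂ} (hs : ∀ i, 1 < (s i).re) :
    HasSum (fun i : ℕ => ((i + 1 : ℕ) : ℂ) ^ (1 - s 0) *
      (tailSeries k i (Fin.tail s) - tailSeries k (i + 1) (Fin.tail s))) (mergedSeries k s) := by
  cases k with
  | zero => simp [tailSeries_zero, mergedSeries]
  | succ k =>
    have h1 : ∀ i, 1 < (Fin.tail s i).re := fun i => hs i.succ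
    have h2 : ∀ i, 1 < ((Fin.cons (s 0 + s 1 - 1) (Fin.tail (Fin.tail s)) :
        Fin (k + 1) → ℂ) i).re := by
      refine Fin.cases ?_ fun i => ?_
      · have := hs 0; have := hs 1; simp; linarith
      · simpa [Fin.tail] using hs i.succ.succ
    refine Eq.mp (congrArg (fun f => HasSum f _) (funext fun i => ?_))
      (hasSum_multiZetaSeries_succ h2)
    rw [tailSeries_sub_tailSeries i h1, Fin.cons_zero, Fin.tail_cons, one_div,
      ← Complex.cpow_neg, ← mul_assoc, ← Complex.cpow_add _ _ (Nat.cast_ne_zero.2 i.succ_ne_zero)]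
    congr 2
    simp only [Fin.tail, Fin.succ_zero_eq_one]
    ring

theorem summable_shiftRemainder_mul_tailSeries {k L : ℕ} {s : Fin (k + 1) → ℂ}
    (hs : ∀ i, 1 < (s i).re) :
    Summable fun i : ℕ =>
      shiftRemainder (L + 2) (i + 1) (s 0) * tailSeries k (i + 1) (Fin.tail s) := by
  obtain ⟨C, hC, hT⟩ := exists_norm_tailSeries_le (s := Fin.tail s) fun i => hs i.succ
  obtain ⟨M, hM, hb⟩ := exists_norm_shiftRemainder_le (L + 2) ‖s 0‖
  have hsum := (summable_nat_add_iff 1).2 (Real.summable_nat_rpow (p := -(s 0).re) |>.2 (by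
    linarith [hs 0]))
  refine Summable.of_norm_bounded ((hsum.mul_left M).mul_right C) fun i => ?_
  rw [norm_mul]
  have h1 := hb (s 0) le_rfl (i + 1) (by omega)
  have h2 : ((i + 1 : ℕ) : ℝ) ^ (1 - (s 0).re - (L + 2 : ℕ)) ≤ ((i + 1 : ℕ) : ℝ) ^ (-(s 0).re) := by
    apply Real.rpow_le_rpow_of_exponent_le
    · push_cast; linarith [(Nat.cast_nonneg i : (0 : ℝ) ≤ i)]
    · push_cast; linarith [(Nat.cast_nonneg L : (0 : ℝ) ≤ L)]
  exact mul_le_mul (h1.trans (mul_le_mul_of_nonneg_left h2 hM)) (hT _) (norm_nonneg _)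
    (by positivity)

/-- The translation formula in the first variable. -/
theorem sub_one_mul_multiZetaSeries {k : ℕ} (L : ℕ) {s : Fin (k + 1) → ℂ}
    (hs : ∀ i, 1 < (s i).re) :
    (s 0 - 1) * multiZetaSeries (k + 1) s =
      multiZetaSeries k (Fin.tail s) - mergedSeries k s +
      ∑ j ∈ Finset.range L, shiftCoeff (j + 2) (s 0) *
        multiZetaSeries (k + 1) (Fin.cons (s 0 + (j + 1)) (Fin.tail s)) +
      ∑' i : ℕ, shiftRemainder (L + 2) (i + 1) (s 0) * tailSeries k (i + 1) (Fin.tail s) := by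
  have hmain := (hasSum_multiZetaSeries_succ hs).mul_left (s 0 - 1)
  have hrem := (summable_shiftRemainder_mul_tailSeries (L := L) hs).hasSum
  have hshift : ∀ j : ℕ, HasSum (fun i : ℕ => shiftCoeff (j + 2) (s 0) *
      (((i + 1 : ℕ) : ℂ) ^ (-(s 0 + (j + 1))) * tailSeries k (i + 1) (Fin.tail s)))
      (shiftCoeff (j + 2) (s 0) *
        multiZetaSeries (k + 1) (Fin.cons (s 0 + (j + 1)) (Fin.tail s))) := by
    intro j
    have hs' : ∀ i, 1 < ((Fin.cons (s 0 + (j + 1)) (Fin.tail s) : Fin (k + 1) → ℂ) i).re := by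
      refine Fin.cases ?_ fun i => ?_
      · have := hs 0
        have := (Nat.cast_nonneg j : (0 : ℝ) ≤ j)
        simp; linarith
      · simpa [Fin.tail] using hs i.succ
    simpa using (hasSum_multiZetaSeries_succ hs').mul_left (shiftCoeff (j + 2) (s 0))
  have hsums := hasSum_sum (s := Finset.range L) fun j _ => hshift j
  have hdiff := (hmain.sub hsums).sub hrem
  have hterm : ∀ i : ℕ, (s 0 - 1) * (((i + 1 : ℕ) : ℂ) ^ (-s 0) * tailSeries k (i + 1) (Fin.tail s))
      - ∑ j ∈ Finset.range L, shiftCoeff (j + 2) (s 0) *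
        (((i + 1 : ℕ) : ℂ) ^ (-(s 0 + (j + 1))) * tailSeries k (i + 1) (Fin.tail s))
      - shiftRemainder (L + 2) (i + 1) (s 0) * tailSeries k (i + 1) (Fin.tail s) =
      (((i + 1 : ℕ) : ℂ) ^ (1 - s 0) - ((i + 2 : ℕ) : ℂ) ^ (1 - s 0)) *
        tailSeries k (i + 1) (Fin.tail s) := by
    intro i
    have := sub_one_mul_cpow_neg L (i + 1) (s 0)
    simp only [← mul_assoc, ← Finset.sum_mul]
    rw [this]
    ring
  simp only [hterm] at hdiff
  have hlim := hdiff.tendsto_sum_nat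
  simp only [sum_range_sub_mul (fun n : ℕ => (n : ℂ) ^ (1 - s 0))
    fun i => tailSeries k i (Fin.tail s)] at hlim
  -- The upper boundary term of the summation by parts vanishes, the tails being bounded and `Re s₁
  -- > 1`. The lower one is `1^{1-s₁} T_0`, the full series of depth `k`.
  have hzero : Tendsto (fun N : ℕ => ((N + 1 : ℕ) : ℂ) ^ (1 - s 0) * tailSeries k N (Fin.tail s))
      atTop (𝓝 0) := by
    obtain ⟨C, hC, hT⟩ := exists_norm_tailSeries_le (s := Fin.tail s) fun i => hs i.succ
    have h1 : Tendsto (fun N : ℕ => ((N + 1 : ℕ) : ℝ) ^ (-((s 0).re - 1)) * C) atTop (𝓝 0) := by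
      have := ((tendsto_rpow_neg_atTop (y := (s 0).re - 1) (by linarith [hs 0])).comp
        (tendsto_natCast_atTop_atTop.comp (tendsto_add_atTop_nat 1))).mul_const C
      simpa [Function.comp_def] using this
    refine squeeze_zero_norm (fun N => ?_) h1
    rw [norm_mul, Complex.norm_natCast_cpow_of_pos (Nat.succ_pos N)]
    have : (1 - s 0).re = -((s 0).re - 1) := by simp
    rw [this]
    gcongr
    exact hT N
  have hlim2 := (tendsto_const_nhds (x := ((1 : ℕ) : ℂ) ^ (1 - s 0) *
    tailSeries k 0 (Fin.tail s))).sub hzero |>.sub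
      (hasSum_cpow_mul_tailSeries_sub hs).tendsto_sum_nat
  have heq := tendsto_nhds_unique hlim hlim2
  rw [Nat.cast_one, Complex.one_cpow, one_mul, sub_zero, ← multiZetaSeries_eq_tailSeries] at heq
  rw [← heq]
  ring

end Translation

/-! ### Quotient representations and uniqueness of the continuation -/

section Quotients

/-- A product of right half-planes. -/
def halfSpace {r : ℕ} (a : Fin r → ℝ) : Set (Fin r → ℂ) := {s | ∀ i, a i < (s i).re}

variable {r : ℕ} {a : Fin r → ℝ}

theorem isOpen_halfSpace (a : Fin r → ℝ) : IsOpen (halfSpace a) := by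
  simp only [halfSpace, Set.ofPred_forall]
  exact isOpen_iInter_of_finite fun i =>
    isOpen_lt continuous_const (Complex.continuous_re.comp (continuous_apply i))

theorem isPreconnected_halfSpace (a : Fin r → ℝ) : IsPreconnected (halfSpace a) := by
  refine Convex.isPreconnected (s := halfSpace a) fun x hx y hy c d hc hd hcd i => ?_
  have h1 := hx i
  have h2 := hy i
  have h3 : ((c • x + d • y) i).re = c * (x i).re + d * (y i).re := by simp
  rw [h3]
  rcases hc.lt_or_eq with h | h
  · have e : c * a i + d * a i = a i := by rw [← add_mul, hcd, one_mul]
    have := mul_lt_mul_of_pos_left h1 h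
    have := mul_le_mul_of_nonneg_left h2.le hd
    linarith
  · have : d = 1 := by linarith
    subst this
    rw [← h]
    linarith

theorem halfSpace_inter (a b : Fin r → ℝ) :
    halfSpace a ∩ halfSpace b = halfSpace fun i => max (a i) (b i) := by
  ext s
  simp [halfSpace, forall_and]

theorem exists_mem_halfSpace_one_lt (a : Fin r → ℝ) :
    ∃ s ∈ halfSpace a, ∀ i, 1 < (s i).re := by
  refine ⟨fun i => ((max (a i) 1 + 1 : ℝ) : ℂ), fun i => ?_, fun i => ?_⟩
  · rw [Complex.ofReal_re]
    linarith [le_max_left (a i) 1]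
  · rw [Complex.ofReal_re]
    linarith [le_max_right (a i) 1]

theorem eventually_one_lt_re {s : Fin r → ℂ} (hs : ∀ i, 1 < (s i).re) :
    ∀ᶠ q in 𝓝 s, ∀ i, 1 < (q i).re :=
  (isOpen_halfSpace fun _ : Fin r => (1 : ℝ)).mem_nhds hs

/-- On `Ω`, the function `f` continues from the region `Re s_i > 1` to the quotient `g / h`. -/
structure IsQuotientOn (f : (Fin r → ℂ) → ℂ) (Ω : Set (Fin r → ℂ)) (g h : (Fin r → ℂ) → ℂ) :
    Prop where
  num : AnalyticOnNhd ℂ g Ω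
  den : AnalyticOnNhd ℂ h Ω
  den_ne : ∀ s ∈ Ω, (∀ i, 1 < (s i).re) → h s ≠ 0
  mul_eq : ∀ s ∈ Ω, (∀ i, 1 < (s i).re) → h s * f s = g s

theorem IsQuotientOn.mono {f g h : (Fin r → ℂ) → ℂ} {Ω Ω' : Set (Fin r → ℂ)}
    (H : IsQuotientOn f Ω g h) (hΩ : Ω' ⊆ Ω) : IsQuotientOn f Ω' g h :=
  ⟨H.num.mono hΩ, H.den.mono hΩ, fun s hs => H.den_ne s (hΩ hs), fun s hs => H.mul_eq s (hΩ hs)⟩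

/-- Identity theorem on half-spaces, for functions that agree where all `Re s_i > 1`. -/
theorem eqOn_halfSpace {φ ψ : (Fin r → ℂ) → ℂ} (hφ : AnalyticOnNhd ℂ φ (halfSpace a))
    (hψ : AnalyticOnNhd ℂ ψ (halfSpace a))
    (h : ∀ s ∈ halfSpace a, (∀ i, 1 < (s i).re) → φ s = ψ s) : Set.EqOn φ ψ (halfSpace a) := by
  obtain ⟨s, hs, hs1⟩ := exists_mem_halfSpace_one_lt a
  refine hφ.eqOn_of_preconnected_of_eventuallyEq hψ (isPreconnected_halfSpace a) hs ?_
  filter_upwards [(isOpen_halfSpace a).mem_nhds hs, eventually_one_lt_re hs1] with q hq hq1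
  exact h q hq hq1

theorem frequently_ne_zero_of_den {h : (Fin r → ℂ) → ℂ} (hh : AnalyticOnNhd ℂ h (halfSpace a))
    (hne : ∀ s ∈ halfSpace a, (∀ i, 1 < (s i).re) → h s ≠ 0) {p : Fin r → ℂ}
    (hp : p ∈ halfSpace a) : ∃ᶠ q in 𝓝 p, h q ≠ 0 := by
  intro hev
  have hev' : h =ᶠ[𝓝 p] 0 := by
    filter_upwards [hev] with q hq
    simpa using hq
  have := hh.eqOn_zero_of_preconnected_of_eventuallyEq_zero (isPreconnected_halfSpace a) hp hev'
  obtain ⟨s, hs, hs1⟩ := exists_mem_halfSpace_one_lt a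
  exact hne s hs hs1 (this hs)

theorem eq_of_frequently_eq {X : Type*} [TopologicalSpace X] {φ ψ : X → ℂ} {p : X}
    (hφ : ContinuousAt φ p) (hψ : ContinuousAt ψ p) (h : ∃ᶠ q in 𝓝 p, φ q = ψ q) :
    φ p = ψ p := by
  by_contra hne
  exact h ((hφ.ne_iff_eventually_ne hψ).1 hne)

/-- The factor `d` may vanish at `p` itself: cancellation at nearby points where `d ≠ 0` passes to
the limit by continuity. -/
theorem eq_of_mul_eq_mul_near {X : Type*} [TopologicalSpace X] {d φ ψ : X → ℂ} {p : X}
    (hd : ∃ᶠ q in 𝓝 p, d q ≠ 0) (hφ : ContinuousAt φ p) (hψ : ContinuousAt ψ p)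
    (h : ∀ᶠ q in 𝓝 p, d q * φ q = d q * ψ q) : φ p = ψ p :=
  eq_of_frequently_eq hφ hψ
    ((hd.and_eventually h).mono fun _ hq => mul_left_cancel₀ hq.1 hq.2)

/-- The intersection of two half-spaces is again a half-space, hence connected and meeting the
region of convergence, where both cross products equal `h h' f`. -/
theorem IsQuotientOn.mul_comm_eqOn {f g h g' h' : (Fin r → ℂ) → ℂ} {b : Fin r → ℝ}
    (H : IsQuotientOn f (halfSpace a) g h) (H' : IsQuotientOn f (halfSpace b) g' h')
    {s : Fin r → ℂ} (ha : s ∈ halfSpace a) (hb : s ∈ halfSpace b) :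
    h s * g' s = h' s * g s := by
  have hsub := halfSpace_inter a b
  have H1 := H.mono (Set.inter_subset_left (t := halfSpace b))
  have H2 := H'.mono (Set.inter_subset_right (s := halfSpace a))
  rw [hsub] at H1 H2
  refine eqOn_halfSpace (H1.den.mul H2.num) (H2.den.mul H1.num) (fun q hq hq1 => ?_)
    (hsub ▸ ⟨ha, hb⟩)
  change h q * g' q = h' q * g q
  rw [← H1.mul_eq q hq hq1, ← H2.mul_eq q hq hq1]
  ring

/-- Any meromorphic continuation agrees with a quotient representation. -/
theorem IsMultiZetaContinuation.mul_eq {V : Set (Fin r → ℂ)} {f g h : (Fin r → ℂ) → ℂ}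
    (hf : IsMultiZetaContinuation r V f)
    (H : IsQuotientOn (multiZetaSeries r) (halfSpace a) g h)
    {p : Fin r → ℂ} (hpV : p ∈ V) (hp : p ∈ halfSpace a) : h p * f p = g p := by
  obtain ⟨hVo, hfa, hfs, hmer⟩ := hf
  -- The identity is propagated along the half-space rather than along `V`, whose connectedness is
  -- not assumed: `A` is open, nonempty and relatively closed there.
  set A : Set (Fin r → ℂ) := {q | ∀ᶠ x in 𝓝 q, x ∈ V → h x * f x = g x} with hA
  have hAo : IsOpen A := isOpen_iff_mem_nhds.2 fun q hq => eventually_eventually_nhds.2 hq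
  have hne : (halfSpace a ∩ A).Nonempty := by
    obtain ⟨s, hs, hs1⟩ := exists_mem_halfSpace_one_lt a
    refine ⟨s, hs, ?_⟩
    filter_upwards [(isOpen_halfSpace a).mem_nhds hs, eventually_one_lt_re hs1] with x hx hx1 hxV
    rw [hfs x hxV hx1, H.mul_eq x hx hx1]
  have hcl : closure A ∩ halfSpace a ⊆ A := by
    rintro q ⟨hqA, hq⟩
    obtain ⟨g', h', hg', hh', hh'0, hev⟩ := hmer q
    obtain ⟨δ, hδ, hball⟩ := Metric.eventually_nhds_iff_ball.1
      (((hg'.eventually_analyticAt.and hh'.eventually_analyticAt).and hev).and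
        ((isOpen_halfSpace a).mem_nhds hq))
    obtain ⟨x, hx, hxA⟩ := mem_closure_iff_nhds.1 hqA _ (Metric.ball_mem_nhds q hδ)
    have hg'B : AnalyticOnNhd ℂ g' (Metric.ball q δ) := fun y hy => (hball y hy).1.1.1
    have hh'B : AnalyticOnNhd ℂ h' (Metric.ball q δ) := fun y hy => (hball y hy).1.1.2
    have hgB : AnalyticOnNhd ℂ g (Metric.ball q δ) := fun y hy => H.num y (hball y hy).2
    have hhB : AnalyticOnNhd ℂ h (Metric.ball q δ) := fun y hy => H.den y (hball y hy).2
    have hconn : IsPreconnected (Metric.ball q δ) := (convex_ball q δ).isPreconnected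
    -- The extra factor `h'` covers the points outside `V`, where it vanishes by the definition of a
    -- continuation.
    have hzero : Set.EqOn (h' * (h * g' - g * h')) 0 (Metric.ball q δ) := by
      refine (hh'B.mul ((hhB.mul hg'B).sub (hgB.mul hh'B))).eqOn_zero_of_preconnected_of_eventuallyEq_zero
        hconn hx ?_
      filter_upwards [hxA, Metric.isOpen_ball.mem_nhds hx] with y hyA hyB
      have hy := (hball y hyB).1.2
      change h' y * (h y * g' y - g y * h' y) = 0
      by_cases hyV : y ∈ V
      · rw [← hy.2 hyV, ← hyA hyV]; ring
      · rw [hy.1 hyV]; ring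
    have hfreq : ∀ y ∈ Metric.ball q δ, ∃ᶠ z in 𝓝 y, h' z ≠ 0 := by
      intro y hy hev0
      have hev0' : h' =ᶠ[𝓝 y] 0 := by
        filter_upwards [hev0] with z hz
        simpa using hz
      have h0 := hh'B.eqOn_zero_of_preconnected_of_eventuallyEq_zero hconn hy hev0'
      exact hh'0 (Filter.mem_of_superset (Metric.ball_mem_nhds q hδ) fun z hz => h0 hz)
    filter_upwards [Metric.ball_mem_nhds q hδ] with y hy hyV
    have hcf := (hfa y hyV).continuousAt
    refine eq_of_mul_eq_mul_near (d := fun z => h' z * h' z)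
      ((hfreq y hy).mono fun z hz => mul_ne_zero hz hz)
      ((hhB y hy).continuousAt.mul hcf) (hgB y hy).continuousAt ?_
    filter_upwards [Metric.isOpen_ball.mem_nhds hy, hVo.mem_nhds hyV] with z hz hzV
    have h1 := hzero hz
    have h2 := (hball z hz).1.2.2 hzV
    simp only [Pi.mul_apply, Pi.sub_apply, Pi.zero_apply] at h1
    rw [← h2] at h1
    change h' z * h' z * (h z * f z) = h' z * h' z * g z
    linear_combination h1
  have hsub := (isPreconnected_halfSpace a).subset_of_closure_inter_subset hAo hne hcl
  exact (hsub hp).self_of_nhds hpV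

/-- `v` is the value at `p` of an analytic continuation near `p` of a quotient representing the
Euler-Zagier series. -/
def IsLocalValue (r : ℕ) (p : Fin r → ℂ) (v : ℂ) : Prop :=
  ∃ (a : Fin r → ℝ) (g h φ : (Fin r → ℂ) → ℂ),
    IsQuotientOn (multiZetaSeries r) (halfSpace a) g h ∧ p ∈ halfSpace a ∧ AnalyticAt ℂ φ p ∧
    (∀ᶠ q in 𝓝 p, h q * φ q = g q) ∧ φ p = v

/-- Cross-multiplying the two representations gives the identity up to the factor `h`, which is
nonzero at points arbitrarily near `p`. Hence a local value does not depend on the chosen quotient.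
-/
theorem mul_eq_of_near {b : Fin r → ℝ} {f g h g' h' φ : (Fin r → ℂ) → ℂ} {p : Fin r → ℂ}
    (H : IsQuotientOn f (halfSpace a) g h)
    (H' : IsQuotientOn f (halfSpace b) g' h')
    (hpa : p ∈ halfSpace a) (hpb : p ∈ halfSpace b) (hφ : AnalyticAt ℂ φ p)
    (hev : ∀ᶠ q in 𝓝 p, h q * φ q = g q) : h' p * φ p = g' p := by
  refine eq_of_mul_eq_mul_near (frequently_ne_zero_of_den H.den H.den_ne hpa)
    ((H'.den p hpb).continuousAt.mul hφ.continuousAt) (H'.num p hpb).continuousAt ?_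
  filter_upwards [hev, (isOpen_halfSpace a).mem_nhds hpa, (isOpen_halfSpace b).mem_nhds hpb]
    with q hq hqa hqb
  have := H.mul_comm_eqOn H' hqa hqb
  change h q * (h' q * φ q) = h q * g' q
  rw [this, ← hq]
  ring

theorem eventually_mul_eq_of_near {b : Fin r → ℝ} {f g h g' h' φ : (Fin r → ℂ) → ℂ}
    {p : Fin r → ℂ} (H : IsQuotientOn f (halfSpace a) g h)
    (H' : IsQuotientOn f (halfSpace b) g' h')
    (hpa : p ∈ halfSpace a) (hpb : p ∈ halfSpace b) (hφ : AnalyticAt ℂ φ p)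
    (hev : ∀ᶠ q in 𝓝 p, h q * φ q = g q) : ∀ᶠ q in 𝓝 p, h' q * φ q = g' q := by
  filter_upwards [eventually_eventually_nhds.2 hev, hφ.eventually_analyticAt,
    (isOpen_halfSpace a).mem_nhds hpa, (isOpen_halfSpace b).mem_nhds hpb] with q hq hqφ hqa hqb
  exact mul_eq_of_near H H' hqa hqb hqφ hq

theorem IsLocalValue.unique {p : Fin r → ℂ} {v v' : ℂ} (hv : IsLocalValue r p v)
    (hv' : IsLocalValue r p v') : v = v' := by
  obtain ⟨a, g, h, φ, H, hpa, hφ, hev, rfl⟩ := hv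
  obtain ⟨b, g', h', φ', H', hpb, hφ', hev', rfl⟩ := hv'
  refine eq_of_mul_eq_mul_near (frequently_ne_zero_of_den H.den H.den_ne hpa)
    hφ.continuousAt hφ'.continuousAt ?_
  filter_upwards [hev, eventually_mul_eq_of_near H' H hpb hpa hφ' hev'] with q h1 h2
  rw [h1, h2]

theorem IsLocalValue.mul_eq {p : Fin r → ℂ} {v : ℂ} (hv : IsLocalValue r p v)
    {g h : (Fin r → ℂ) → ℂ} (H : IsQuotientOn (multiZetaSeries r) (halfSpace a) g h)
    (hp : p ∈ halfSpace a) : h p * v = g p := by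
  obtain ⟨b, g', h', φ, H', hpb, hφ, hev, rfl⟩ := hv
  exact mul_eq_of_near H' H hpb hp hφ hev

theorem isLocalValue_of_den_ne_zero {g h : (Fin r → ℂ) → ℂ} {p : Fin r → ℂ}
    (H : IsQuotientOn (multiZetaSeries r) (halfSpace a) g h) (hp : p ∈ halfSpace a)
    (hne : h p ≠ 0) : IsLocalValue r p (g p / h p) := by
  refine ⟨a, g, h, fun q => g q / h q, H, hp, (H.num p hp).div (H.den p hp) hne, ?_, rfl⟩
  filter_upwards [(H.den p hp).continuousAt.eventually_ne hne] with q hq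
  field_simp

/-- The Euler-Zagier series has quotient representations on half-spaces exhausting `ℂ^r`. -/
def HasQuotients (r : ℕ) : Prop :=
  ∀ ρ : ℕ, ∃ g h, IsQuotientOn (multiZetaSeries r) (halfSpace fun _ : Fin r => -(ρ : ℝ)) g h

theorem exists_mem_halfSpace_neg (p : Fin r → ℂ) :
    ∃ ρ : ℕ, p ∈ halfSpace fun _ : Fin r => -(ρ : ℝ) := by
  obtain ⟨ρ, hρ⟩ := exists_nat_gt ‖p‖
  refine ⟨ρ, fun i => ?_⟩
  have h1 := (Complex.abs_re_le_norm (p i)).trans (norm_le_pi_norm p i)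
  linarith [neg_abs_le (p i).re]

open Classical in
/-- The function given by all local values. -/
def localValue (r : ℕ) (p : Fin r → ℂ) : ℂ :=
  if H : ∃ v, IsLocalValue r p v then H.choose else 0

theorem IsLocalValue.localValue_eq {p : Fin r → ℂ} {v : ℂ} (hv : IsLocalValue r p v) :
    localValue r p = v := by
  have H : ∃ v, IsLocalValue r p v := ⟨v, hv⟩
  rw [localValue, dif_pos H]
  exact H.choose_spec.unique hv

theorem IsLocalValue.exists_analyticAt {p : Fin r → ℂ} {v : ℂ} (hv : IsLocalValue r p v) :
    ∃ φ : (Fin r → ℂ) → ℂ, AnalyticAt ℂ φ p ∧ ∀ᶠ q in 𝓝 p, IsLocalValue r q (φ q) := by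
  obtain ⟨a, g, h, φ, H, hpa, hφ, hev, rfl⟩ := hv
  refine ⟨φ, hφ, ?_⟩
  filter_upwards [eventually_eventually_nhds.2 hev, hφ.eventually_analyticAt,
    (isOpen_halfSpace a).mem_nhds hpa] with q hq hqφ hqa
  exact ⟨a, g, h, φ, H, hqa, hqφ, hq, rfl⟩

/-- Local values are unique, so they glue to one analytic function on the set where they exist. A
point without a local value must be a zero of every denominator available there, which gives the
meromorphy condition. -/
theorem isMultiZetaContinuation_localValue (hQ : HasQuotients r) :
    IsMultiZetaContinuation r {p | ∃ v, IsLocalValue r p v} (localValue r) := by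
  refine ⟨?_, ?_, ?_, ?_⟩
  · refine isOpen_iff_mem_nhds.2 ?_
    rintro p ⟨v, hv⟩
    obtain ⟨φ, -, hev⟩ := hv.exists_analyticAt
    exact hev.mono fun q hq => ⟨_, hq⟩
  · rintro p ⟨v, hv⟩
    obtain ⟨φ, hφ, hev⟩ := hv.exists_analyticAt
    exact hφ.congr (hev.mono fun q hq => hq.localValue_eq.symm)
  · rintro s ⟨v, hv⟩ hs
    obtain ⟨ρ, hρ⟩ := exists_mem_halfSpace_neg s
    obtain ⟨g, h, H⟩ := hQ ρ
    rw [hv.localValue_eq]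
    have h1 := hv.mul_eq H hρ
    rw [← H.mul_eq s hρ hs] at h1
    exact mul_left_cancel₀ (H.den_ne s hρ hs) h1
  · intro p
    obtain ⟨ρ, hρ⟩ := exists_mem_halfSpace_neg p
    obtain ⟨g, h, H⟩ := hQ ρ
    refine ⟨g, h, H.num p hρ, H.den p hρ, ?_, ?_⟩
    · have := frequently_ne_zero_of_den H.den H.den_ne hρ
      intro hev
      exact this (hev.mono fun q hq => by simpa using hq)
    · filter_upwards [(isOpen_halfSpace _).mem_nhds hρ] with q hq
      refine ⟨fun hn => ?_, ?_⟩
      · by_contra hne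
        exact hn ⟨_, isLocalValue_of_den_ne_zero H hq hne⟩
      · rintro ⟨v, hv⟩
        rw [hv.localValue_eq]
        exact hv.mul_eq H hq

theorem IsMultiZetaContinuation.isLocalValue (hQ : HasQuotients r) {V : Set (Fin r → ℂ)}
    {f : (Fin r → ℂ) → ℂ} (hf : IsMultiZetaContinuation r V f) {p : Fin r → ℂ} (hp : p ∈ V) :
    IsLocalValue r p (f p) := by
  obtain ⟨ρ, hρ⟩ := exists_mem_halfSpace_neg p
  obtain ⟨g, h, H⟩ := hQ ρ
  refine ⟨_, g, h, f, H, hρ, hf.2.1 p hp, ?_, rfl⟩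
  filter_upwards [hf.1.mem_nhds hp, (isOpen_halfSpace _).mem_nhds hρ] with q hq hqρ
  exact hf.mul_eq H hq hqρ

theorem multiZetaRegularAt_iff (hQ : HasQuotients r) {p : Fin r → ℂ} :
    MultiZetaRegularAt r p ↔ ∃ v, IsLocalValue r p v := by
  constructor
  · rintro ⟨V, f, hf, hp⟩
    exact ⟨_, hf.isLocalValue hQ hp⟩
  · intro h
    exact ⟨_, _, isMultiZetaContinuation_localValue hQ, h⟩

theorem MultiZetaRegularAt.isLocalValue (hQ : HasQuotients r) {p : Fin r → ℂ}
    (hp : MultiZetaRegularAt r p) : IsLocalValue r p (multiZeta r p) := by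
  rw [multiZeta, dif_pos hp]
  have := hp.choose_spec.choose_spec
  exact this.1.isLocalValue hQ this.2

theorem IsLocalValue.multiZeta_eq (hQ : HasQuotients r) {p : Fin r → ℂ} {v : ℂ}
    (hv : IsLocalValue r p v) : multiZeta r p = v :=
  (((multiZetaRegularAt_iff hQ).2 ⟨v, hv⟩).isLocalValue hQ).unique hv

theorem MultiZetaRegularAt.eventually {p : Fin r → ℂ}
    (hp : MultiZetaRegularAt r p) : ∀ᶠ q in 𝓝 p, MultiZetaRegularAt r q := by
  obtain ⟨V, f, hf, hpV⟩ := hp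
  exact Filter.mem_of_superset (hf.1.mem_nhds hpV) fun q hq => ⟨V, f, hf, hq⟩

theorem MultiZetaRegularAt.analyticAt (hQ : HasQuotients r) {p : Fin r → ℂ}
    (hp : MultiZetaRegularAt r p) : AnalyticAt ℂ (multiZeta r) p := by
  obtain ⟨φ, hφ, hev⟩ := (hp.isLocalValue hQ).exists_analyticAt
  exact hφ.congr (hev.mono fun q hq => (hq.multiZeta_eq hQ).symm)

end Quotients

/-! ### Existence of the meromorphic continuation -/

section Existence

theorem analyticAt_coord {k : ℕ} (i : Fin k) (s : Fin k → ℂ) :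
    AnalyticAt ℂ (fun q : Fin k → ℂ => q i) s :=
  (ContinuousLinearMap.proj (R := ℂ) (φ := fun _ : Fin k => ℂ) i).analyticAt s

theorem analyticAt_tail {k : ℕ} (s : Fin (k + 1) → ℂ) :
    AnalyticAt ℂ (fun q : Fin (k + 1) → ℂ => (Fin.tail q : Fin k → ℂ)) s :=
  AnalyticAt.pi fun i => analyticAt_coord i.succ s

theorem AnalyticAt.finCons {E : Type*} [NormedAddCommGroup E] [NormedSpace ℂ E] {k : ℕ}
    {φ : E → ℂ} {ψ : E → Fin k → ℂ} {x : E} (hφ : AnalyticAt ℂ φ x) (hψ : AnalyticAt ℂ ψ x) :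
    AnalyticAt ℂ (fun y => (Fin.cons (φ y) (ψ y) : Fin (k + 1) → ℂ)) x := by
  refine AnalyticAt.pi fun i => ?_
  refine Fin.cases ?_ (fun i => ?_) i
  · simpa using hφ
  · simpa using (analyticAt_coord i (ψ x)).fun_comp hψ

/-- Existence of a quotient representation. -/
def HasQuotientOn {r : ℕ} (f : (Fin r → ℂ) → ℂ) (Ω : Set (Fin r → ℂ)) : Prop :=
  ∃ g h, IsQuotientOn f Ω g h

namespace HasQuotientOn

variable {r r' : ℕ} {f f' c : (Fin r → ℂ) → ℂ} {Ω : Set (Fin r → ℂ)}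

theorem congr (H : HasQuotientOn f Ω) (hf : ∀ s ∈ Ω, (∀ i, 1 < (s i).re) → f s = f' s) :
    HasQuotientOn f' Ω :=
  let ⟨g, h, H⟩ := H
  ⟨g, h, H.num, H.den, H.den_ne, fun s hs hs1 => hf s hs hs1 ▸ H.mul_eq s hs hs1⟩

theorem of_analytic (hc : AnalyticOnNhd ℂ c Ω) : HasQuotientOn c Ω :=
  ⟨c, fun _ => 1, hc, analyticOnNhd_const, fun _ _ _ => one_ne_zero, fun _ _ _ => one_mul _⟩

theorem add (H : HasQuotientOn f Ω) (H' : HasQuotientOn f' Ω) :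
    HasQuotientOn (fun s => f s + f' s) Ω := by
  obtain ⟨g, h, H⟩ := H
  obtain ⟨g', h', H'⟩ := H'
  refine ⟨fun s => g s * h' s + g' s * h s, fun s => h s * h' s,
    (H.num.mul H'.den).add (H'.num.mul H.den), H.den.mul H'.den,
    fun s hs hs1 => mul_ne_zero (H.den_ne s hs hs1) (H'.den_ne s hs hs1), fun s hs hs1 => ?_⟩
  rw [← H.mul_eq s hs hs1, ← H'.mul_eq s hs hs1]
  ring

theorem analytic_mul (hc : AnalyticOnNhd ℂ c Ω) (H : HasQuotientOn f Ω) :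
    HasQuotientOn (fun s => c s * f s) Ω := by
  obtain ⟨g, h, H⟩ := H
  refine ⟨fun s => c s * g s, h, hc.mul H.num, H.den, H.den_ne, fun s hs hs1 => ?_⟩
  rw [← H.mul_eq s hs hs1]
  ring

theorem sub (H : HasQuotientOn f Ω) (H' : HasQuotientOn f' Ω) :
    HasQuotientOn (fun s => f s - f' s) Ω :=
  (H.add (H'.analytic_mul (c := fun _ => -1) analyticOnNhd_const)).congr fun s _ _ => by ring

theorem sum {ι : Type*} (t : Finset ι) {F : ι → (Fin r → ℂ) → ℂ}
    (H : ∀ i ∈ t, HasQuotientOn (F i) Ω) : HasQuotientOn (fun s => ∑ i ∈ t, F i s) Ω := by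
  classical
  induction t using Finset.induction_on with
  | empty => simpa using of_analytic analyticOnNhd_const
  | insert i t hi ih =>
    simp only [Finset.sum_insert hi]
    exact (H i (Finset.mem_insert_self i t)).add
      (ih fun j hj => H j (Finset.mem_insert_of_mem hj))

theorem of_mul (hc : AnalyticOnNhd ℂ c Ω) (hc0 : ∀ s ∈ Ω, (∀ i, 1 < (s i).re) → c s ≠ 0)
    (H : HasQuotientOn (fun s => c s * f s) Ω) : HasQuotientOn f Ω := by
  obtain ⟨g, h, H⟩ := H
  refine ⟨g, fun s => h s * c s, H.num, H.den.mul hc,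
    fun s hs hs1 => mul_ne_zero (H.den_ne s hs hs1) (hc0 s hs hs1), fun s hs hs1 => ?_⟩
  rw [← H.mul_eq s hs hs1]
  ring

theorem comp {Ξ : Set (Fin r' → ℂ)} {θ : (Fin r' → ℂ) → Fin r → ℂ} (H : HasQuotientOn f Ω)
    (hθ : AnalyticOnNhd ℂ θ Ξ) (hmaps : Set.MapsTo θ Ξ Ω)
    (hre : ∀ s ∈ Ξ, (∀ i, 1 < (s i).re) → ∀ i, 1 < (θ s i).re) :
    HasQuotientOn (fun s => f (θ s)) Ξ := by
  obtain ⟨g, h, H⟩ := H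
  exact ⟨fun s => g (θ s), fun s => h (θ s), H.num.comp hθ hmaps, H.den.comp hθ hmaps,
    fun s hs hs1 => H.den_ne _ (hmaps hs) (hre s hs hs1),
    fun s hs hs1 => H.mul_eq _ (hmaps hs) (hre s hs hs1)⟩

end HasQuotientOn

/-- The continuation of the Euler-Zagier series over `n < n₁ < ⋯ < n_k`, by inclusion-exclusion. -/
def tailZeta : (k : ℕ) → ℕ → (Fin k → ℂ) → ℂ
  | 0, _, _ => 1
  | k + 1, n, s => multiZeta (k + 1) s -
      ∑ m ∈ Finset.range n, 1 / (((m + 1 : ℕ) : ℂ) ^ (s 0)) * tailZeta k (m + 1) (Fin.tail s)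

/-- All the points `(s_{k-j+1}, …, s_k)` with `1 ≤ j ≤ k` are regular. -/
def TailsRegular : (k : ℕ) → (Fin k → ℂ) → Prop
  | 0, _ => True
  | k + 1, s => MultiZetaRegularAt (k + 1) s ∧ TailsRegular k (Fin.tail s)

/-- Simultaneous quotient representations of the tails of the Euler-Zagier series, with a common
denominator and numerators of at most polynomial growth. -/
structure IsTailQuotient (k ρ : ℕ) (H : (Fin k → ℂ) → ℂ) (Γ : ℕ → (Fin k → ℂ) → ℂ) : Prop where
  num : ∀ n, AnalyticOnNhd ℂ (Γ n) (halfSpace fun _ => -(ρ : ℝ))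
  den : AnalyticOnNhd ℂ H (halfSpace fun _ => -(ρ : ℝ))
  den_ne : ∀ s ∈ halfSpace (fun _ : Fin k => -(ρ : ℝ)), (∀ i, 1 < (s i).re) → H s ≠ 0
  mul_eq : ∀ s ∈ halfSpace (fun _ : Fin k => -(ρ : ℝ)), (∀ i, 1 < (s i).re) →
    ∀ n, H s * tailSeries k n s = Γ n s
  mul_tailZeta : ∀ s ∈ halfSpace (fun _ : Fin k => -(ρ : ℝ)), TailsRegular k s →
    ∀ n, H s * tailZeta k n s = Γ n s
  bound : ∀ p ∈ halfSpace (fun _ : Fin k => -(ρ : ℝ)), ∃ B : ℝ, 0 ≤ B ∧ ∀ᶠ q in 𝓝 p,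
    ∀ n : ℕ, 1 ≤ n → ‖Γ n q‖ ≤ B * (n : ℝ) ^ (k * (ρ + 1))

theorem norm_one_div_natCast_cpow_le {ρ n : ℕ} (hn : 1 ≤ n) {w : ℂ} (hw : -(ρ : ℝ) ≤ w.re) :
    ‖1 / ((n : ℂ) ^ w)‖ ≤ (n : ℝ) ^ ρ := by
  rw [one_div, ← Complex.cpow_neg, Complex.norm_natCast_cpow_of_pos hn, ← Real.rpow_natCast]
  apply Real.rpow_le_rpow_of_exponent_le (by exact_mod_cast hn)
  rw [Complex.neg_re]
  linarith

/-- There are `n` terms, each with a power at most `n^ρ`. One level of inclusion-exclusion therefore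
costs `ρ + 1` in the growth exponent, and `k` levels cost `k (ρ + 1)`. -/
theorem norm_sum_range_one_div_mul_le {ρ A n : ℕ} (hn : 1 ≤ n) {w : ℂ} (hw : -(ρ : ℝ) ≤ w.re)
    {B : ℝ} (hB : 0 ≤ B) {T : ℕ → ℂ} (hT : ∀ m : ℕ, 1 ≤ m → ‖T m‖ ≤ B * (m : ℝ) ^ A) :
    ‖∑ m ∈ Finset.range n, 1 / (((m + 1 : ℕ) : ℂ) ^ w) * T (m + 1)‖ ≤
      B * (n : ℝ) ^ (A + (ρ + 1)) := by
  have hle : ∀ m ∈ Finset.range n, ‖1 / (((m + 1 : ℕ) : ℂ) ^ w) * T (m + 1)‖ ≤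
      (n : ℝ) ^ ρ * (B * (n : ℝ) ^ A) := by
    intro m hm
    have hmn : ((m + 1 : ℕ) : ℝ) ≤ n := by exact_mod_cast Finset.mem_range.1 hm
    rw [norm_mul]
    refine mul_le_mul ((norm_one_div_natCast_cpow_le (Nat.le_add_left 1 m) hw).trans ?_)
      ((hT _ (Nat.le_add_left 1 m)).trans ?_) (norm_nonneg _) (by positivity)
    · gcongr
    · gcongr
  refine (norm_sum_le_of_le _ hle).trans_eq ?_
  rw [Finset.sum_const, Finset.card_range, nsmul_eq_mul]
  ring

theorem tail_mem_halfSpace {k : ℕ} {b c : ℝ} {s : Fin (k + 1) → ℂ}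
    (hs : s ∈ halfSpace (Fin.cons b fun _ => c : Fin (k + 1) → ℝ)) :
    Fin.tail s ∈ halfSpace fun _ : Fin k => c := fun i => by
  simpa [Fin.tail] using hs i.succ

theorem cons_const {k : ℕ} (c : ℝ) :
    (Fin.cons c fun _ => c : Fin (k + 1) → ℝ) = fun _ => c := by
  funext i
  refine Fin.cases ?_ (fun i => ?_) i <;> simp

theorem analyticAt_one_div_natCast_cpow {k m : ℕ} (s : Fin (k + 1) → ℂ) :
    AnalyticAt ℂ (fun s : Fin (k + 1) → ℂ => 1 / (((m + 1 : ℕ) : ℂ) ^ (s 0))) s := by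
  have h1 := (analyticOnNhd_natCast_cpow (Nat.le_add_left 1 m) analyticOnNhd_id.neg) (s 0) trivial
  have h2 := AnalyticAt.fun_comp (f := fun q : Fin (k + 1) → ℂ => q 0) h1 (analyticAt_coord 0 s)
  refine h2.congr (Eventually.of_forall fun q => ?_)
  simp [Complex.cpow_neg]

theorem eventually_norm_le_of_continuousAt {X : Type*} [TopologicalSpace X] {φ : X → ℂ} {p : X}
    (hφ : ContinuousAt φ p) : ∀ᶠ q in 𝓝 p, ‖φ q‖ ≤ ‖φ p‖ + 1 :=
  (hφ.norm.eventually_lt_const (lt_add_one _)).mono fun _ h => h.le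

/-- The tails of depth `k + 1` are one function minus finite sums of tails of depth `k`. The product
of the denominator of that function with the common one of depth `k` serves all `n`, so series over
`n` can later be summed with a single denominator. -/
theorem exists_isTailQuotient {k : ℕ} (hQ : ∀ j ≤ k, HasQuotients j) (ρ : ℕ) :
    ∃ H Γ, IsTailQuotient k ρ H Γ := by
  induction k with
  | zero =>
    refine ⟨fun _ => 1, fun _ _ => 1, fun _ => analyticOnNhd_const, analyticOnNhd_const,
      fun _ _ _ => one_ne_zero, fun s _ _ n => ?_, fun s _ _ n => ?_, fun p _ =>
      ⟨1, zero_le_one, Eventually.of_forall fun q n hn => ?_⟩⟩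
    · rw [tailSeries_zero, mul_one]
    · rw [tailZeta, mul_one]
    · simp
  | succ k ih =>
    obtain ⟨H, Γ, hT⟩ := ih fun j hj => hQ j (hj.trans k.le_succ)
    obtain ⟨g, h, hgh⟩ := hQ (k + 1) le_rfl ρ
    have htail : ∀ s ∈ halfSpace (fun _ : Fin (k + 1) => -(ρ : ℝ)),
        Fin.tail s ∈ halfSpace fun _ : Fin k => -(ρ : ℝ) := fun s hs i => hs i.succ
    have hH : AnalyticOnNhd ℂ (fun s : Fin (k + 1) → ℂ => H (Fin.tail s))
        (halfSpace fun _ => -(ρ : ℝ)) := fun s hs =>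
      AnalyticAt.fun_comp (hT.den _ (htail s hs)) (analyticAt_tail s)
    refine ⟨fun s => h s * H (Fin.tail s), fun n s => g s * H (Fin.tail s) - h s *
      ∑ m ∈ Finset.range n, 1 / (((m + 1 : ℕ) : ℂ) ^ (s 0)) * Γ (m + 1) (Fin.tail s),
      fun n => ?_, hgh.den.mul hH, fun s hs hs1 => ?_, fun s hs hs1 n => ?_, fun s hs hreg n => ?_,
      fun p hp => ?_⟩
    · refine (hgh.num.mul hH).sub (hgh.den.mul ?_)
      refine Finset.analyticOnNhd_fun_sum _ fun m _ s hs => ?_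
      exact (analyticAt_one_div_natCast_cpow s).mul
        (AnalyticAt.fun_comp (hT.num (m + 1) _ (htail s hs)) (analyticAt_tail s))
    · exact mul_ne_zero (hgh.den_ne s hs hs1) (hT.den_ne _ (htail s hs) fun i => hs1 i.succ)
    · have := hT.mul_eq _ (htail s hs) fun i => hs1 i.succ
      rw [tailSeries_succ_eq_sub_sum n hs1, ← hgh.mul_eq s hs hs1]
      simp only [← this, Finset.mul_sum, mul_sub]
      congr 1
      · ring
      · exact Finset.sum_congr rfl fun m _ => by ring
    · have := hT.mul_tailZeta _ (htail s hs) hreg.2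
      have h1 := (hreg.1.isLocalValue (hQ (k + 1) le_rfl)).mul_eq hgh hs
      rw [tailZeta, ← h1]
      simp only [← this, Finset.mul_sum, mul_sub]
      congr 1
      · ring
      · exact Finset.sum_congr rfl fun m _ => by ring
    · obtain ⟨B, hB0, hB⟩ := hT.bound _ (htail p hp)
      have h1 := eventually_norm_le_of_continuousAt ((hgh.num p hp).continuousAt.mul
        (hH p hp).continuousAt)
      have h2 := eventually_norm_le_of_continuousAt (hgh.den p hp).continuousAt
      refine ⟨‖g p * H (Fin.tail p)‖ + 1 + (‖h p‖ + 1) * B, by positivity, ?_⟩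
      filter_upwards [h1, h2, (analyticAt_tail p).continuousAt.eventually hB,
        (isOpen_halfSpace _).mem_nhds hp] with q hq1 hq2 hq3 hq n hn
      have h3 := norm_sum_range_one_div_mul_le hn (hq 0).le hB0 hq3
      have hexp : k * (ρ + 1) + (ρ + 1) = (k + 1) * (ρ + 1) := by ring
      rw [hexp] at h3
      have hone : (1 : ℝ) ≤ (n : ℝ) ^ ((k + 1) * (ρ + 1)) :=
        one_le_pow₀ (by exact_mod_cast hn)
      refine (norm_sub_le _ _).trans ?_
      rw [add_mul]
      refine add_le_add (hq1.trans (le_mul_of_one_le_right (by positivity) hone)) ?_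
      rw [norm_mul, mul_assoc]
      exact mul_le_mul hq2 h3 (norm_nonneg _) (by positivity)

theorem summable_const_mul_inv_sq (M : ℝ) :
    Summable fun i : ℕ => M * (((i + 1 : ℕ) : ℝ) ^ 2)⁻¹ :=
  ((summable_nat_add_iff 1).2 (Real.summable_nat_pow_inv.2 one_lt_two)).mul_left M

theorem norm_mul_le_of_growth {A i : ℕ} {c γ : ℂ} {M B : ℝ} (hM : 0 ≤ M)
    (hc : ‖c‖ ≤ M * (((i + 1 : ℕ) : ℝ) ^ (A + 2))⁻¹) (hγ : ‖γ‖ ≤ B * ((i + 1 : ℕ) : ℝ) ^ A) :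
    ‖c * γ‖ ≤ M * B * (((i + 1 : ℕ) : ℝ) ^ 2)⁻¹ := by
  rw [norm_mul]
  have hpos : (0 : ℝ) < ((i + 1 : ℕ) : ℝ) := by positivity
  calc _ ≤ M * (((i + 1 : ℕ) : ℝ) ^ (A + 2))⁻¹ * (B * ((i + 1 : ℕ) : ℝ) ^ A) :=
        mul_le_mul hc hγ (norm_nonneg _) (by positivity)
    _ = _ := by rw [pow_add]; field_simp

/-- Coefficients decaying like `n^{-(A+2)}`, with `A = k (ρ + 1)`, beat the growth `n^A` of the
numerators and leave the convergent series of `n^{-2}`. -/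
theorem IsTailQuotient.isQuotientOn_tsum {k ρ : ℕ} {H : (Fin k → ℂ) → ℂ}
    {Γ : ℕ → (Fin k → ℂ) → ℂ} (hT : IsTailQuotient k ρ H Γ) {c : ℕ → ℂ → ℂ} {b : ℝ}
    (hc : ∀ i, AnalyticOnNhd ℂ (c i) Set.univ)
    (hcb : ∀ w : ℂ, b < w.re → ∃ M : ℝ, 0 ≤ M ∧ ∀ᶠ z in 𝓝 w, ∀ i,
      ‖c i z‖ ≤ M * (((i + 1 : ℕ) : ℝ) ^ (k * (ρ + 1) + 2))⁻¹) :
    IsQuotientOn (fun s => ∑' i, c i (s 0) * tailSeries k (i + 1) (Fin.tail s))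
      (halfSpace (Fin.cons b fun _ => -(ρ : ℝ)))
      (fun s => ∑' i, c i (s 0) * Γ (i + 1) (Fin.tail s)) (fun s => H (Fin.tail s)) := by
  refine ⟨fun p hp => ?_, fun s hs => ?_, fun s hs hs1 => ?_, fun s hs hs1 => ?_⟩
  · obtain ⟨M, hM, hMb⟩ := hcb (p 0) (by simpa using hp 0)
    obtain ⟨B, hB, hBb⟩ := hT.bound _ (tail_mem_halfSpace hp)
    refine analyticAt_tsum (summable_const_mul_inv_sq (M * B)) ?_ ?_
    · filter_upwards [(isOpen_halfSpace _).mem_nhds hp] with q hq i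
      exact (AnalyticAt.fun_comp (hc i _ trivial) (analyticAt_coord 0 q)).mul
        (AnalyticAt.fun_comp (hT.num (i + 1) _ (tail_mem_halfSpace hq)) (analyticAt_tail q))
    · filter_upwards [(analyticAt_coord 0 p).continuousAt.eventually hMb,
        (analyticAt_tail p).continuousAt.eventually hBb] with q h1 h2 i
      exact norm_mul_le_of_growth hM (h1 i) (h2 (i + 1) (Nat.le_add_left 1 i))
  · exact AnalyticAt.fun_comp (hT.den _ (tail_mem_halfSpace hs)) (analyticAt_tail s)
  · exact hT.den_ne _ (tail_mem_halfSpace hs) fun i => hs1 i.succ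
  · rw [← tsum_mul_left]
    refine tsum_congr fun i => ?_
    rw [← hT.mul_eq _ (tail_mem_halfSpace hs) (fun i => hs1 i.succ)]
    ring

theorem norm_natCast_cpow_neg_le {i A : ℕ} {z : ℂ} (hz : (A : ℝ) ≤ z.re) :
    ‖((i + 1 : ℕ) : ℂ) ^ (-z)‖ ≤ (((i + 1 : ℕ) : ℝ) ^ A)⁻¹ := by
  rw [Complex.norm_natCast_cpow_of_pos i.succ_pos, ← Real.rpow_natCast,
    ← Real.rpow_neg (by positivity)]
  apply Real.rpow_le_rpow_of_exponent_le
  · exact_mod_cast Nat.le_add_left 1 i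
  · rw [Complex.neg_re]; linarith

theorem IsTailQuotient.isQuotientOn_multiZetaSeries {k ρ : ℕ} {H : (Fin k → ℂ) → ℂ}
    {Γ : ℕ → (Fin k → ℂ) → ℂ} (hT : IsTailQuotient k ρ H Γ) :
    IsQuotientOn (multiZetaSeries (k + 1))
      (halfSpace (Fin.cons ((k * (ρ + 1) + 2 : ℕ) : ℝ) fun _ => -(ρ : ℝ)))
      (fun s => ∑' i : ℕ, ((i + 1 : ℕ) : ℂ) ^ (-s 0) * Γ (i + 1) (Fin.tail s))
      (fun s => H (Fin.tail s)) := by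
  have h1 := hT.isQuotientOn_tsum (c := fun i w => ((i + 1 : ℕ) : ℂ) ^ (-w))
    (b := ((k * (ρ + 1) + 2 : ℕ) : ℝ))
    (fun i => analyticOnNhd_natCast_cpow (Nat.le_add_left 1 i) analyticOnNhd_id.neg)
    (fun w hw => ⟨1, zero_le_one, by
      filter_upwards [Complex.continuous_re.continuousAt.eventually_const_lt hw] with z hz i
      rw [one_mul]
      exact norm_natCast_cpow_neg_le hz.le⟩)
  refine ⟨h1.num, h1.den, h1.den_ne, fun s hs hs1 => ?_⟩
  rw [← h1.mul_eq s hs hs1, (hasSum_multiZetaSeries_succ hs1).tsum_eq]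

theorem hasQuotientOn_of_large {k ρ : ℕ} (hQ : ∀ j ≤ k, HasQuotients j) :
    HasQuotientOn (multiZetaSeries (k + 1))
      (halfSpace (Fin.cons ((k * (ρ + 1) + 2 : ℕ) : ℝ) fun _ => -(ρ : ℝ))) :=
  let ⟨_, _, hT⟩ := exists_isTailQuotient hQ ρ
  ⟨_, _, hT.isQuotientOn_multiZetaSeries⟩

/-- A remainder of order `L + 2` has size `n^{-(Re s₁ + L + 1)}`, so the abscissa moves `L + 1`
units to the left. -/
theorem hasQuotientOn_tsum_shiftRemainder {k ρ : ℕ} (hQ : ∀ j ≤ k, HasQuotients j) (L : ℕ) :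
    HasQuotientOn (fun s : Fin (k + 1) → ℂ =>
        ∑' i, shiftRemainder (L + 2) (i + 1) (s 0) * tailSeries k (i + 1) (Fin.tail s))
      (halfSpace (Fin.cons ((k * (ρ + 1) + 2 : ℕ) - L - 1 : ℝ) fun _ => -(ρ : ℝ))) := by
  obtain ⟨H, Γ, hT⟩ := exists_isTailQuotient hQ ρ
  refine ⟨_, _, hT.isQuotientOn_tsum (c := fun i w => shiftRemainder (L + 2) (i + 1) w)
    (fun i => analyticOnNhd_shiftRemainder _ (Nat.le_add_left 1 i)) fun w hw => ?_⟩
  obtain ⟨M, hM, hb⟩ := exists_norm_shiftRemainder_le (L + 2) (‖w‖ + 1)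
  refine ⟨M, hM, ?_⟩
  filter_upwards [Complex.continuous_re.continuousAt.eventually_const_lt hw,
    (continuous_norm.continuousAt (x := w)).eventually_lt_const (lt_add_one _)] with z hz hz1 i
  refine (hb z hz1.le (i + 1) (Nat.le_add_left 1 i)).trans ?_
  gcongr
  rw [← Real.rpow_natCast, ← Real.rpow_neg (by positivity)]
  apply Real.rpow_le_rpow_of_exponent_le
  · exact_mod_cast Nat.le_add_left 1 i
  · push_cast at hz ⊢; linarith

theorem HasQuotients.comp {r r' : ℕ} (hQ : HasQuotients r) {Ξ : Set (Fin r' → ℂ)}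
    {θ : (Fin r' → ℂ) → Fin r → ℂ} {c : ℝ}
    (hθ : AnalyticOnNhd ℂ θ Ξ) (hc : ∀ s ∈ Ξ, ∀ i, c < (θ s i).re)
    (hre : ∀ s ∈ Ξ, (∀ i, 1 < (s i).re) → ∀ i, 1 < (θ s i).re) :
    HasQuotientOn (fun s => multiZetaSeries r (θ s)) Ξ := by
  obtain ⟨ρ, hρ⟩ := exists_nat_gt (-c)
  exact HasQuotientOn.comp (hQ ρ) hθ (fun s hs i => by
    have := hc s hs i
    linarith) hre

theorem hasQuotientOn_mergedSeries {k : ℕ} (hQ : ∀ j ≤ k, HasQuotients j) (b c : ℝ) :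
    HasQuotientOn (mergedSeries k) (halfSpace (Fin.cons b fun _ => c)) := by
  cases k with
  | zero => exact HasQuotientOn.of_analytic (c := fun _ => 0) analyticOnNhd_const
  | succ k =>
    refine (hQ (k + 1) le_rfl).comp (c := min (b + c - 1) c) (fun s hs => ?_) (fun s hs => ?_)
      fun s hs hs1 => ?_
    · exact (((analyticAt_coord 0 s).add (analyticAt_coord 1 s)).sub analyticAt_const).finCons
        (AnalyticAt.fun_comp (analyticAt_tail (Fin.tail s)) (analyticAt_tail s))
    · have h0 : b < (s 0).re := by simpa using hs 0
      have h1 : ∀ i : Fin (k + 1), c < (s i.succ).re := fun i => by simpa using hs i.succ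
      have h2 := h1 0
      rw [Fin.succ_zero_eq_one] at h2
      refine Fin.cases ?_ fun i => ?_
      · refine (min_le_left _ _).trans_lt ?_
        simp; linarith
      · exact (min_le_right _ _).trans_lt (by simpa [Fin.tail] using h1 i.succ)
    · have h0 := hs1 0
      have h1 := hs1 1
      refine Fin.cases ?_ fun i => ?_
      · simp; linarith
      · simpa [Fin.tail] using hs1 i.succ.succ

/-- Each step solves the translation formula with `L = i` for `ζ_{k+1}`: the shifted terms lie at
least one unit to the right, inside the domain already reached, and the others have depth at most
`k` or are the remainder. The factor `s₁ - 1` joins the denominator. -/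
theorem hasQuotientOn_multiZetaSeries_succ {k ρ : ℕ} (hQ : ∀ j ≤ k, HasQuotients j) (i : ℕ) :
    HasQuotientOn (multiZetaSeries (k + 1))
      (halfSpace (Fin.cons ((k * (ρ + 1) + 2 : ℕ) - i : ℝ) fun _ => -(ρ : ℝ))) := by
  induction i with
  | zero => simpa using hasQuotientOn_of_large (ρ := ρ) hQ
  | succ i ih =>
    set b : ℝ := ((k * (ρ + 1) + 2 : ℕ) - (i + 1 : ℕ) : ℝ) with hb
    have hb' : ((k * (ρ + 1) + 2 : ℕ) - i : ℝ) = b + 1 := by rw [hb]; push_cast; ring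
    have hb'' : ((k * (ρ + 1) + 2 : ℕ) - i - 1 : ℝ) = b := by rw [hb]; push_cast; ring
    rw [hb'] at ih
    have hrem := hasQuotientOn_tsum_shiftRemainder (ρ := ρ) hQ i
    rw [hb''] at hrem
    have htail : HasQuotientOn (fun s : Fin (k + 1) → ℂ => multiZetaSeries k (Fin.tail s))
        (halfSpace (Fin.cons b fun _ => -(ρ : ℝ))) :=
      (hQ k le_rfl).comp (fun s _ => analyticAt_tail s) (fun s hs => tail_mem_halfSpace hs)
        fun s _ hs1 i => hs1 i.succ
    have hshift : ∀ j ∈ Finset.range i, HasQuotientOn (fun s : Fin (k + 1) → ℂ =>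
        shiftCoeff (j + 2) (s 0) *
          multiZetaSeries (k + 1) (Fin.cons (s 0 + (j + 1)) (Fin.tail s)))
        (halfSpace (Fin.cons b fun _ => -(ρ : ℝ))) := by
      intro j _
      have hj : (0 : ℝ) ≤ j := Nat.cast_nonneg j
      refine HasQuotientOn.analytic_mul (fun s _ =>
        AnalyticAt.fun_comp (analyticOnNhd_shiftCoeff (j + 2) _ trivial) (analyticAt_coord 0 s)) ?_
      refine ih.comp (fun s _ => ((analyticAt_coord 0 s).add analyticAt_const).finCons
        (analyticAt_tail s)) (fun s hs => ?_) fun s hs hs1 => ?_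
      · refine Fin.cases ?_ fun l => ?_
        · have := hs 0
          simp at this ⊢; linarith
        · simpa [Fin.tail] using hs l.succ
      · refine Fin.cases ?_ fun l => ?_
        · have := hs1 0
          simp; linarith
        · simpa [Fin.tail] using hs1 l.succ
    have hall := ((htail.sub (hasQuotientOn_mergedSeries hQ b _)).add
      (HasQuotientOn.sum _ hshift)).add hrem
    refine HasQuotientOn.of_mul (c := fun s => s 0 - 1)
      (fun s _ => (analyticAt_coord 0 s).sub analyticAt_const) (fun s _ hs1 h0 => ?_)
      (hall.congr fun s _ hs1 => (sub_one_mul_multiZetaSeries i hs1).symm)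
    have := hs1 0
    rw [sub_eq_zero.1 h0] at this
    simp at this

theorem hasQuotients (r : ℕ) : HasQuotients r := by
  induction r using Nat.strong_induction_on with
  | _ r ih =>
    intro ρ
    cases r with
    | zero =>
      refine HasQuotientOn.congr (f := fun _ => 1) (HasQuotientOn.of_analytic analyticOnNhd_const)
        fun s _ _ => ?_
      rw [multiZetaSeries_eq_tailSeries, tailSeries_zero]
    | succ k =>
      -- This number of unit steps brings the abscissa from `k (ρ + 1) + 2` down to `-ρ`.
      have := hasQuotientOn_multiZetaSeries_succ (ρ := ρ)
        (fun j hj => ih j (Nat.lt_succ_of_le hj)) (k * (ρ + 1) + 2 + ρ)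
      have hb : ((k * (ρ + 1) + 2 : ℕ) - (k * (ρ + 1) + 2 + ρ : ℕ) : ℝ) = -(ρ : ℝ) := by
        push_cast; ring
      rw [hb, cons_const] at this
      exact this

end Existence

/-! ### The limit as `Re s₁ → +∞` -/

section Limit

theorem lastEntries_last {k : ℕ} (s : Fin (k + 1) → ℂ) : lastEntries s (Fin.last k) = s := by
  funext i
  simp only [lastEntries]
  congr 1
  ext
  simp

theorem lastEntries_castSucc {k : ℕ} (s : Fin (k + 1) → ℂ) (j : Fin k) :
    lastEntries s j.castSucc = lastEntries (Fin.tail s) j := by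
  funext i
  have hj := j.2
  simp only [lastEntries, Fin.tail]
  congr 1
  ext
  simp only [Fin.val_castSucc, Fin.succ_mk]
  omega

theorem tailsRegular_of_lastEntries {k : ℕ} {t : Fin k → ℂ}
    (h : ∀ j : Fin k, MultiZetaRegularAt (j.1 + 1) (lastEntries t j)) : TailsRegular k t := by
  induction k with
  | zero => trivial
  | succ k ih =>
    refine ⟨?_, ih fun j => ?_⟩
    · have := h (Fin.last k)
      rw [lastEntries_last] at this
      exact this
    · have := h j.castSucc
      rw [lastEntries_castSucc] at this
      exact this

/-- For `n = 1` the inclusion-exclusion sum has the single coefficient `1^{-s} = 1`, so the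
recursion unwinds to the alternating sum. -/
theorem tailZeta_one_eq_limitF {k : ℕ} (t : Fin k → ℂ) : tailZeta k 1 t = limitF k t := by
  induction k with
  | zero => simp [tailZeta, limitF]
  | succ k ih =>
    rw [tailZeta, limitF, Fin.sum_univ_castSucc, Finset.sum_range_one]
    simp only [lastEntries_last, lastEntries_castSucc]
    have h1 : ((0 + 1 : ℕ) : ℂ) = 1 := by simp
    have h2 : ∀ j : Fin k, (-1 : ℂ) ^ ((k + 1 + 1) - (j.castSucc.1 + 1) + 1) *
        multiZeta (j.castSucc.1 + 1) (lastEntries (Fin.tail t) j) =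
        -((-1 : ℂ) ^ ((k + 1) - (j.1 + 1) + 1) *
        multiZeta (j.1 + 1) (lastEntries (Fin.tail t) j)) := by
      intro j
      have hj := j.2
      have : (k + 1 + 1) - (j.castSucc.1 + 1) + 1 = ((k + 1) - (j.1 + 1) + 1) + 1 := by
        rw [Fin.val_castSucc]; omega
      rw [this, pow_succ]
      change _ * multiZeta (j.1 + 1) _ = _
      ring
    rw [h1, Complex.one_cpow, ih, limitF, Finset.sum_congr rfl fun j _ => h2 j]
    have h3 : (-1 : ℂ) ^ ((k + 1 + 1) - ((Fin.last k).1 + 1) + 1) = 1 := by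
      rw [Fin.val_last]
      have : k + 1 + 1 - (k + 1) + 1 = 2 := by omega
      rw [this]; norm_num
    rw [h3, Finset.sum_neg_distrib, pow_succ (-1 : ℂ) (k + 1)]
    change multiZeta (k + 1) t - _ = _ + 1 * multiZeta (k + 1) t - _
    ring

theorem TailsRegular.eventually {k : ℕ} {t : Fin k → ℂ} (ht : TailsRegular k t) :
    ∀ᶠ q in 𝓝 t, TailsRegular k q := by
  induction k with
  | zero => exact Eventually.of_forall fun _ => trivial
  | succ k ih =>
    filter_upwards [ht.1.eventually, (analyticAt_tail t).continuousAt.eventually (ih ht.2)]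
      with q h1 h2
    exact ⟨h1, h2⟩

theorem TailsRegular.analyticAt_tailZeta {k : ℕ} {t : Fin k → ℂ} (ht : TailsRegular k t) (n : ℕ) :
    AnalyticAt ℂ (tailZeta k n) t := by
  induction k generalizing n with
  | zero => exact analyticAt_const
  | succ k ih =>
    refine (ht.1.analyticAt (hasQuotients _)).sub (Finset.analyticAt_fun_sum _ fun m _ => ?_)
    exact (analyticAt_one_div_natCast_cpow t).mul
      (AnalyticAt.fun_comp (ih ht.2 (m + 1)) (analyticAt_tail t))

theorem exists_norm_tailZeta_le {k ρ : ℕ} {K : Set (Fin k → ℂ)} (hK : IsCompact K)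
    (hreg : ∀ t ∈ K, TailsRegular k t) (hρ : K ⊆ halfSpace fun _ => -(ρ : ℝ)) :
    ∃ B : ℝ, 0 ≤ B ∧ ∀ t ∈ K, ∀ n : ℕ, 1 ≤ n →
      ‖tailZeta k n t‖ ≤ B * (n : ℝ) ^ (k * (ρ + 1)) := by
  induction k with
  | zero => exact ⟨1, zero_le_one, fun t _ n _ => by simp [tailZeta]⟩
  | succ k ih =>
    have hcont : Continuous fun s : Fin (k + 1) → ℂ => (Fin.tail s : Fin k → ℂ) :=
      continuous_iff_continuousAt.2 fun s => (analyticAt_tail s).continuousAt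
    obtain ⟨B, hB, hb⟩ := ih (hK.image hcont)
      (by rintro _ ⟨s, hs, rfl⟩; exact (hreg s hs).2)
      (by rintro _ ⟨s, hs, rfl⟩ i; exact hρ hs i.succ)
    obtain ⟨C, hC⟩ := hK.exists_bound_of_continuousOn (f := multiZeta (k + 1)) fun t ht =>
      ((hreg t ht).1.analyticAt (hasQuotients _)).continuousAt.continuousWithinAt
    refine ⟨|C| + B, by positivity, fun t ht n hn => ?_⟩
    have h3 := norm_sum_range_one_div_mul_le hn (hρ ht 0).le hB
      (hb (Fin.tail t) ⟨t, ht, rfl⟩)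
    have hexp : k * (ρ + 1) + (ρ + 1) = (k + 1) * (ρ + 1) := by ring
    rw [hexp] at h3
    have hone : (1 : ℝ) ≤ (n : ℝ) ^ ((k + 1) * (ρ + 1)) := one_le_pow₀ (by exact_mod_cast hn)
    rw [tailZeta, add_mul]
    exact (norm_sub_le _ _).trans (add_le_add (((hC t ht).trans (le_abs_self C)).trans
      (le_mul_of_one_le_right (abs_nonneg C) hone)) h3)

/-- The series is analytic near `z` by domination, and multiplying it by the common denominator `H`
gives termwise the numerator of a quotient representation. The interior of `K` supplies the
neighbourhood on which the bound holds. -/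
theorem isLocalValue_tsum_tailZeta {k ρ : ℕ} {K : Set (Fin k → ℂ)} {B : ℝ} {z : Fin (k + 1) → ℂ}
    (hreg : ∀ t ∈ K, TailsRegular k t) (hρ : K ⊆ halfSpace fun _ => -(ρ : ℝ))
    (hB : ∀ t ∈ K, ∀ n : ℕ, 1 ≤ n → ‖tailZeta k n t‖ ≤ B * (n : ℝ) ^ (k * (ρ + 1)))
    (hz0 : ((k * (ρ + 1) + 2 : ℕ) : ℝ) < (z 0).re) (hz : Fin.tail z ∈ interior K) :
    IsLocalValue (k + 1) z
      (∑' i : ℕ, ((i + 1 : ℕ) : ℂ) ^ (-z 0) * tailZeta k (i + 1) (Fin.tail z)) := by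
  obtain ⟨H, Γ, hT⟩ := exists_isTailQuotient (k := k) (fun j _ => hasQuotients j) ρ
  have hnear : ∀ᶠ q in 𝓝 z, ((k * (ρ + 1) + 2 : ℕ) : ℝ) < (q 0).re ∧ (Fin.tail q : Fin k → ℂ) ∈ K := by
    refine Eventually.and ?_ ?_
    · exact (Complex.continuous_re.comp (continuous_apply 0)).continuousAt.eventually_const_lt hz0
    · exact (analyticAt_tail z).continuousAt.eventually
        (mem_interior_iff_mem_nhds.1 hz : ∀ᶠ t in 𝓝 (Fin.tail z), t ∈ K)
  refine ⟨_, _, _, fun s => ∑' i : ℕ, ((i + 1 : ℕ) : ℂ) ^ (-s 0) * tailZeta k (i + 1) (Fin.tail s),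
    hT.isQuotientOn_multiZetaSeries, ?_, ?_, ?_, rfl⟩
  · refine Fin.cases ?_ fun i => ?_
    · simpa using hz0
    · simpa [Fin.tail] using hρ (interior_subset hz) i
  · refine analyticAt_tsum (summable_const_mul_inv_sq (1 * B)) ?_ ?_
    · filter_upwards [hnear] with q hq i
      refine AnalyticAt.mul ?_
        (AnalyticAt.fun_comp ((hreg _ hq.2).analyticAt_tailZeta (i + 1)) (analyticAt_tail q))
      exact AnalyticAt.fun_comp (f := fun q : Fin (k + 1) → ℂ => q 0)
        (analyticOnNhd_natCast_cpow (Nat.le_add_left 1 i) analyticOnNhd_id.neg (q 0) trivial)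
        (analyticAt_coord 0 q)
    · filter_upwards [hnear] with q hq i
      refine norm_mul_le_of_growth zero_le_one ?_ (hB _ hq.2 (i + 1) (Nat.le_add_left 1 i))
      rw [one_mul]
      exact norm_natCast_cpow_neg_le hq.1.le
  · filter_upwards [hnear] with q hq
    rw [← tsum_mul_left]
    refine tsum_congr fun i => ?_
    rw [← hT.mul_tailZeta _ (hρ hq.2) (hreg _ hq.2)]
    ring

/-- For `n ≥ 2` the power `n^{-Re w}` splits as `n^{-(A+2)}`, which absorbs the growth of `T`, times
`n^{-(Re w - A - 2)}`, which is at most its value at `n = 2`. -/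
theorem norm_tsum_sub_first_le {A : ℕ} {B : ℝ} {w : ℂ} {T : ℕ → ℂ}
    (hB : ∀ n : ℕ, 1 ≤ n → ‖T n‖ ≤ B * (n : ℝ) ^ A) (hw : ((A + 2 : ℕ) : ℝ) ≤ w.re) :
    ‖(∑' i : ℕ, ((i + 1 : ℕ) : ℂ) ^ (-w) * T (i + 1)) - T 1‖ ≤
      B * (∑' i : ℕ, (((i + 1 : ℕ) : ℝ) ^ 2)⁻¹) * (2 : ℝ) ^ (-(w.re - (A + 2 : ℕ))) := by
  have hB0 : 0 ≤ B := by simpa using (norm_nonneg _).trans (hB 1 le_rfl)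
  have hsq : Summable fun i : ℕ => (((i + 1 : ℕ) : ℝ) ^ 2)⁻¹ := by
    simpa using summable_const_mul_inv_sq 1
  have hsum : Summable fun i : ℕ => ((i + 1 : ℕ) : ℂ) ^ (-w) * T (i + 1) :=
    Summable.of_norm_bounded (summable_const_mul_inv_sq (1 * B)) fun i =>
      norm_mul_le_of_growth zero_le_one
        (by rw [one_mul]; exact norm_natCast_cpow_neg_le hw) (hB (i + 1) (Nat.le_add_left 1 i))
  have hfirst : ((0 + 1 : ℕ) : ℂ) ^ (-w) * T (0 + 1) = T 1 := by simp
  rw [hsum.tsum_eq_zero_add, hfirst, add_sub_cancel_left]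
  have hsq1 := (summable_nat_add_iff 1).2 hsq
  have hle : ∑' i : ℕ, (((i + 1 + 1 : ℕ) : ℝ) ^ 2)⁻¹ ≤ ∑' i : ℕ, (((i + 1 : ℕ) : ℝ) ^ 2)⁻¹ := by
    rw [hsq.tsum_eq_zero_add]
    exact le_add_of_nonneg_left (by positivity)
  set c : ℝ := (2 : ℝ) ^ (-(w.re - (A + 2 : ℕ))) with hc
  have hc0 : 0 ≤ c := by positivity
  have hterm : ∀ i : ℕ, ‖((i + 1 + 1 : ℕ) : ℂ) ^ (-w) * T (i + 1 + 1)‖ ≤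
      B * c * (((i + 1 + 1 : ℕ) : ℝ) ^ 2)⁻¹ := by
    intro i
    have hpos : (0 : ℝ) < ((i + 1 + 1 : ℕ) : ℝ) := by positivity
    rw [mul_comm B c]
    refine norm_mul_le_of_growth (A := A) hc0 ?_ (hB (i + 1 + 1) (Nat.le_add_left 1 _))
    rw [Complex.norm_natCast_cpow_of_pos (Nat.succ_pos _)]
    have hexp : (-w).re = -(w.re - (A + 2 : ℕ)) + -((A + 2 : ℕ) : ℝ) := by
      rw [Complex.neg_re]; ring
    rw [hexp, Real.rpow_add hpos, Real.rpow_neg hpos.le ((A + 2 : ℕ) : ℝ), Real.rpow_natCast]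
    refine mul_le_mul_of_nonneg_right ?_ (by positivity)
    refine Real.rpow_le_rpow_of_nonpos two_pos ?_ (by linarith)
    exact_mod_cast Nat.le_add_left 2 i
  refine (tsum_of_norm_bounded (hsq1.hasSum.mul_left (B * c)) hterm).trans ?_
  calc B * c * ∑' i : ℕ, (((i + 1 + 1 : ℕ) : ℝ) ^ 2)⁻¹
      ≤ B * c * ∑' i : ℕ, (((i + 1 : ℕ) : ℝ) ^ 2)⁻¹ := by gcongr
    _ = _ := by ring

theorem exists_forall_mul_two_rpow_neg_lt {C ε : ℝ} (hC : 0 ≤ C) (hε : 0 < ε) :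
    ∃ Y : ℝ, 0 < Y ∧ ∀ y, Y ≤ y → C * (2 : ℝ) ^ (-y) < ε := by
  refine ⟨1 + C / ε, by positivity, fun y hy => ?_⟩
  have hy1 : 1 ≤ y := le_trans (by simpa using div_nonneg hC hε.le) hy
  -- Bernoulli's inequality gives `2^y ≥ 1 + y`, which exceeds `C / ε` for `y ≥ 1 + C / ε`.
  have h1 := one_add_mul_self_le_rpow_one_add (s := 1) (by norm_num) hy1
  have h2 : C / ε < (2 : ℝ) ^ y := by
    norm_num at h1
    linarith
  rw [Real.rpow_neg two_pos.le, ← div_eq_mul_inv, div_lt_iff₀ (by positivity), mul_comm]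
  exact (div_lt_iff₀ hε).1 h2

theorem exists_uniform_bound {k : ℕ} {D : Set (Fin k → ℂ)} (hD : Bornology.IsBounded D)
    (hreg : ∀ t ∈ closure D, TailsRegular k t) {ε : ℝ} (hε : 0 < ε) :
    ∃ X : ℝ, ∀ z : Fin (k + 1) → ℂ, X ≤ (z 0).re → Fin.tail z ∈ D →
      MultiZetaRegularAt (k + 1) z ∧ ‖multiZeta (k + 1) z - limitF k (Fin.tail z)‖ < ε := by
  have hopen : IsOpen {t : Fin k → ℂ | TailsRegular k t} :=
    isOpen_iff_mem_nhds.2 fun t ht => TailsRegular.eventually ht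
  -- Regularity is an open condition and the closure of `D` is compact, so there is room for a
  -- compact neighbourhood of regular tails. Bounds on it are uniform, and it contains a
  -- neighbourhood of each tail in `D`, as analyticity requires.
  obtain ⟨K, hK, hDK, hKreg⟩ := exists_compact_between hD.isCompact_closure hopen hreg
  obtain ⟨R, hR⟩ := hK.isBounded.exists_norm_le
  obtain ⟨ρ, hρR⟩ := exists_nat_gt R
  have hρ : K ⊆ halfSpace fun _ => -(ρ : ℝ) := fun t ht i => by
    have h1 := (Complex.abs_re_le_norm (t i)).trans (norm_le_pi_norm t i)
    linarith [neg_abs_le (t i).re, hR t ht]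
  obtain ⟨B, hB0, hB⟩ := exists_norm_tailZeta_le hK hKreg hρ
  obtain ⟨Y, hY, hYb⟩ := exists_forall_mul_two_rpow_neg_lt
    (C := B * ∑' i : ℕ, (((i + 1 : ℕ) : ℝ) ^ 2)⁻¹) (by positivity) hε
  refine ⟨((k * (ρ + 1) + 2 : ℕ) : ℝ) + Y, fun z hz hzD => ?_⟩
  have hzK : Fin.tail z ∈ interior K := hDK (subset_closure hzD)
  have hval := isLocalValue_tsum_tailZeta hKreg hρ hB (by linarith) hzK
  refine ⟨(multiZetaRegularAt_iff (hasQuotients _)).2 ⟨_, hval⟩, ?_⟩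
  rw [hval.multiZeta_eq (hasQuotients _), ← tailZeta_one_eq_limitF]
  refine (norm_tsum_sub_first_le (T := fun n => tailZeta k n (Fin.tail z))
    (hB _ (interior_subset hzK)) (by linarith)).trans_lt (hYb _ (by linarith))

end Limit

end

theorem theorem2 (k : ℕ) (D : Set (Fin k → ℂ)) (hD : Bornology.IsBounded D)
    (hreg : ∀ t ∈ closure D, ∀ j : Fin k, lastEntries t j ∉ multiZetaSingularities (j.1 + 1)) :
    (∀ ε : ℝ, 0 < ε → ∃ X : ℝ, ∀ z : Fin (k + 1) → ℂ, X ≤ (z 0).re → Fin.tail z ∈ D →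
      z ∉ multiZetaSingularities (k + 1) ∧
      ‖multiZeta (k + 1) z - limitF k (Fin.tail z)‖ < ε) ∧
    (∀ s : ℕ → Fin (k + 1) → ℂ,
      Filter.Tendsto (fun m => (s m 0).re) Filter.atTop Filter.atTop →
      (∀ m, Fin.tail (s m) ∈ D) →
      ∀ ε : ℝ, 0 < ε → ∃ M : ℕ, ∀ m ≥ M,
        s m ∉ multiZetaSingularities (k + 1) ∧
        ‖multiZeta (k + 1) (s m) - limitF k (Fin.tail (s m))‖ < ε) := by
  have hreg' : ∀ t ∈ closure D, TailsRegular k t := fun t ht =>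
    tailsRegular_of_lastEntries fun j => not_not.1 (hreg t ht j)
  have hmain : ∀ ε : ℝ, 0 < ε → ∃ X : ℝ, ∀ z : Fin (k + 1) → ℂ, X ≤ (z 0).re → Fin.tail z ∈ D →
      z ∉ multiZetaSingularities (k + 1) ∧
      ‖multiZeta (k + 1) z - limitF k (Fin.tail z)‖ < ε := by
    intro ε hε
    obtain ⟨X, hX⟩ := exists_uniform_bound hD hreg' hε
    exact ⟨X, fun z hz hzD => ⟨not_not.2 (hX z hz hzD).1, (hX z hz hzD).2⟩⟩
  refine ⟨hmain, fun s hs hsD ε hε => ?_⟩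
  obtain ⟨X, hX⟩ := hmain ε hε
  obtain ⟨M, hM⟩ := eventually_atTop.1 (hs.eventually_ge_atTop X)
  exact ⟨M, fun m hm => hX (s m) (hM m hm) (hsD m)⟩
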